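/- **Setting.** Let $\sigma\in\{-1,+1\}$ and let $r$ be an integer with $r\ge 1$ if $\sigma=-1$ and $r\ge 3$ if $\sigma=+1$. Put $D=r^2-4\sigma$, $\lambda=\frac{r+\sqrt D}{2}>1$, $\overline\lambda=\frac{r-\sqrt D}{2}$, and let $T=T_{r,\sigma}$ be the automorphism of $\mathbb T^2=\mathbb R^2/\mathbb Z^2$ given by the companion matrix $C_{r,\sigma}=\begin{pmatrix} r&1\\-\sigma&0\end{pmatrix}$. Let $\widetilde{\mathfrak X}$ be the additive semigroup of all two-sided sequences $\varepsilon=(\varepsilon_n)_{n\in\mathbb Z}$ of nonnegative integers for which $\sum_{n\ge1}\varepsilon_n\lambda^{-n}$ and $\sum_{n\ge1}\varepsilon_{-n}\lambda^{-n}$ converge, with coordinatewise addition, the topology of coordinatewise convergence and the shift $(\tau\varepsilon)_n=\varepsilon_{n+1}$. An *arithmetic coding* of $T$ is a pair $(\varphi,\mathfrak X)$ in which $\varphi:\widetilde{\mathfrak X}\to\mathbb T^2$ is an additive map with $\varphi\tau=T\varphi$ that is continuous on $\{\varepsilon:\varepsilon_n\le w_n\ \forall n\in\mathbb Z\}$ for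 every $w\in\widetilde{\mathfrak X}$, and $\mathfrak X\subset\widetilde{\mathfrak X}$ is closed, shift-invariant ($\tau\varepsilon\in\mathfrak X\iff\varepsilon\in\mathfrak X$) and such that 1. $\mathfrak X$ is total: if $\varepsilon\in\mathfrak X$, $\varepsilon'\in\widetilde{\mathfrak X}$ and, for some $N\in\mathbb Z$, every tail $(\varepsilon'_k,\varepsilon'_{k+1},\dots)$, $k\in\mathbb Z$, is lexicographically (strictly) less than $(\varepsilon_N,\varepsilon_{N+1},\dots)$, then $\varepsilon'\in\mathfrak X$; 2. $\varphi(\mathfrak X)=\mathbb T^2$, and $\varphi$ is one-to-one on the set of those elements of $\mathfrak X$ that have only finitely many nonzero coordinates. It is a *bijective arithmetic coding* (BAC) if in addition Lebesgue-almost every point of $\mathbb T^2$ has exactly one preimage under $\varphi|_{\mathfrak X}$. A map $\varphi$ on $\widetilde{\mathfrak X}$ is called a BAC if $(\varphi,\mathfrak X)$ is a BAC for some $\mathfrak X$. For $\xi\in\mathbb R$ let $$L_\xi(\varepsilon)=\Bigl(\sum_{n=-\infty}^{\infty}\varepsilon_n\lambda^{-n}\Bigr)\begin{pmatrix}\xi\\-\sigma\xi\lambda^{-1}\end{pmatrix}\bmod\mathbb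 Z^2:=\lim_{N\to\infty}\Bigl[\Bigl(\sum_{n=-N}^{N}\varepsilon_n\lambda^{-n}\Bigr)\begin{pmatrix}\xi\\-\sigma\xi\lambda^{-1}\end{pmatrix}\bmod\mathbb Z^2\Bigr],\qquad \varepsilon\in\widetilde{\mathfrak X},$$ whenever these limits in $\mathbb T^2$ exist. The symbolic compactum $\mathfrak X_{r,\sigma}$ is, for $\sigma=-1$, the set of sequences with $0\le\varepsilon_n\le r$ and $\varepsilon_n=r\Rightarrow\varepsilon_{n+1}=0$; for $\sigma=+1$, the set of sequences with $0\le\varepsilon_n\le r-1$ that contain no block $(r-1)(r-2)^j(r-1)$, $j\ge0$. **Theorem 2.2.** (a) $T_{r,\sigma}$ admits a bijective arithmetic coding. (b) If $(r,\sigma)\ne(3,+1)$, a map $\varphi:\widetilde{\mathfrak X}\to\mathbb T^2$ is a BAC of $T_{r,\sigma}$ if and only if $\varphi=L_\xi$ with $\xi=\dfrac{\pm\lambda^k}{\sqrt D}$ for some $k\in\mathbb Z$ and some choice of the sign. (c) If $(r,\sigma)=(3,+1)$ (so $D=5$, $\lambda=\frac{3+\sqrt5}{2}$), a map $\varphi:\widetilde{\mathfrak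 X}\to\mathbb T^2$ is a BAC of $T_{3,+1}$ if and only if $\varphi=L_\xi$ with $\xi=\dfrac{\pm\theta^k}{\sqrt D}$ for some $k\in\mathbb Z$ and some choice of the sign, where $\theta=\sqrt\lambda=\frac{1+\sqrt5}{2}$. (d) For all $(m,n)\in\mathbb Z^2\setminus\{(0,0)\}$ and $\xi=\dfrac{m+n\lambda}{\sqrt D}$, the map $L_\xi$ is defined on $\widetilde{\mathfrak X}$, and its restriction to $\mathfrak X_{r,\sigma}$ is $K$-to-one over Lebesgue-almost every point of $\mathbb T^2$, where $K=|D\,N(\xi)|$, $N(\xi)=\xi\overline\xi$ and $\overline\xi=-\dfrac{m+n\overline\lambda}{\sqrt D}$. -/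

import Mathlib

open MeasureTheory Filter Topology

/-- The 2-torus `ℝ² / ℤ²`; its `volume` is the normalized Lebesgue measure. -/
abbrev Torus2 : Type := Fin 2 → UnitAddCircle

/-- The endomorphism of the torus given by an integer matrix
(an automorphism if the determinant is `±1`). -/
def toralMap (M : Matrix (Fin 2) (Fin 2) ℤ) (x : Torus2) : Torus2 :=
  fun i => ∑ j, M i j • x j

/-- The companion matrix with trace `r` and determinant `σ`. -/
def companionMatrix (r : ℕ) (σ : ℤ) : Matrix (Fin 2) (Fin 2) ℤ :=
  !![(r : ℤ), 1; -σ, 0]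

/-- The discriminant `D = r² - 4σ` of the characteristic polynomial `x² - r x + σ`. -/
def discrD (M : Matrix (Fin 2) (Fin 2) ℤ) : ℝ :=
  (M.trace : ℝ) ^ 2 - 4 * (M.det : ℝ)

/-- The eigenvalue `λ = (r + √D) / 2`. -/
noncomputable def eigenLam (M : Matrix (Fin 2) (Fin 2) ℤ) : ℝ :=
  ((M.trace : ℝ) + Real.sqrt (discrD M)) / 2

/-- The algebraic conjugate `(r - √D) / 2` of `λ`. -/
noncomputable def eigenLamConj (M : Matrix (Fin 2) (Fin 2) ℤ) : ℝ :=
  ((M.trace : ℝ) - Real.sqrt (discrD M)) / 2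

/-- The primary symbolic set: the semigroup of all two-sided sequences `ε` of nonnegative integers
such that `∑_{n ≥ 1} ε_n λ^{-n}` and `∑_{n ≥ 1} ε_{-n} λ^{-n}` converge. It carries the topology
of coordinatewise convergence (as a subspace of the product of discrete spaces). -/
def PrimarySet (lam : ℝ) : AddSubmonoid (ℤ → ℕ) where
  carrier := {ε | Summable (fun n : ℕ => (ε ((n : ℤ) + 1) : ℝ) / lam ^ (n + 1)) ∧
    Summable (fun n : ℕ => (ε (-((n : ℤ) + 1)) : ℝ) / lam ^ (n + 1))}
  zero_mem' := by
    constructor <;> simp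
  add_mem' := by
    rintro a b ⟨ha, ha'⟩ ⟨hb, hb'⟩
    constructor
    · refine (ha.add hb).congr fun n => ?_
      simp [add_div]
    · refine (ha'.add hb').congr fun n => ?_
      simp [add_div]

theorem shift_mem {lam : ℝ} (ε : PrimarySet lam) :
    (fun n : ℤ => ε.1 (n + 1)) ∈ PrimarySet lam := by
  obtain ⟨ε, h1, h2⟩ := ε
  by_cases hl : lam = 0
  · subst hl
    constructor <;> simp
  constructor
  · have h := ((summable_nat_add_iff 1).2 h1).mul_right lam
    refine h.congr fun n => ?_
    push_cast
    rw [pow_succ lam (n + 1)]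
    field_simp
  · refine (summable_nat_add_iff 1).1 ?_
    refine (h2.div_const lam).congr fun n => ?_
    have e : -(((n + 1 : ℕ) : ℤ) + 1) + 1 = -((n : ℤ) + 1) := by push_cast; ring
    simp only [e]
    rw [pow_succ lam (n + 1), div_div]

/-- The two-sided shift `(τ ε)_n = ε_{n+1}`. -/
def shift {lam : ℝ} (ε : PrimarySet lam) : PrimarySet lam :=
  ⟨fun n : ℤ => ε.1 (n + 1), shift_mem ε⟩

/-- The (strict) lexicographic order on one-sided sequences. -/
def LexLess (a b : ℕ → ℕ) : Prop :=
  ∃ n, a n < b n ∧ ∀ m < n, a m = b m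

/-- `X` is total: if `ε ∈ X` and all one-sided tails of `ε'` are lexicographically less than one
fixed tail `(ε_N, ε_{N+1}, …)` of `ε`, then `ε' ∈ X`. -/
def IsTotalSet {lam : ℝ} (X : Set (PrimarySet lam)) : Prop :=
  ∀ ε ∈ X, ∀ ε' : PrimarySet lam,
    (∃ N : ℤ, ∀ k : ℤ,
      LexLess (fun j : ℕ => ε'.1 (k + (j : ℤ))) (fun j : ℕ => ε.1 (N + (j : ℤ)))) → ε' ∈ X

/-- `(φ, X)` is an arithmetic coding of the hyperbolic automorphism of the torus given by `M`.
Continuity of `φ` is with respect to coordinatewise convergence on each set of sequences that is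
dominated by a member of the primary symbolic set. -/
structure IsArithmeticCoding (M : Matrix (Fin 2) (Fin 2) ℤ)
    (φ : PrimarySet (eigenLam M) → Torus2) (X : Set (PrimarySet (eigenLam M))) : Prop where
  map_add : ∀ ε ε', φ (ε + ε') = φ ε + φ ε'
  continuousOn : ∀ w : PrimarySet (eigenLam M), ContinuousOn φ {ε | ∀ n, ε.1 n ≤ w.1 n}
  map_shift : ∀ ε, φ (shift ε) = toralMap M (φ ε)
  isClosed : IsClosed X
  shift_invariant : ∀ ε, shift ε ∈ X ↔ ε ∈ X
  total : IsTotalSet X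
  surjective : φ '' X = Set.univ
  injOn_finite : Set.InjOn φ {ε | ε ∈ X ∧ (Function.support ε.1).Finite}

/-- A bijective arithmetic coding: `φ` restricted to `X` is one-to-one over Lebesgue-almost every
point of the torus. -/
def IsBijectiveArithmeticCoding (M : Matrix (Fin 2) (Fin 2) ℤ)
    (φ : PrimarySet (eigenLam M) → Torus2) (X : Set (PrimarySet (eigenLam M))) : Prop :=
  IsArithmeticCoding M φ X ∧ ∀ᵐ x ∂(volume : Measure Torus2), ∃! ε, ε ∈ X ∧ φ ε = x

/-- `φ = L_ξ`, that is, for every `ε` the limit of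
`(∑_{|n| ≤ N} ε_n λ^{-n}) • (ξ, -σ ξ λ⁻¹) mod ℤ²` as `N → ∞` exists and equals `φ ε`. -/
def IsLMap (r : ℕ) (σ : ℤ) (ξ : ℝ)
    (φ : PrimarySet (eigenLam (companionMatrix r σ)) → Torus2) : Prop :=
  ∀ ε, Tendsto
    (fun N : ℕ => fun i : Fin 2 =>
      (((∑ n ∈ Finset.Icc (-(N : ℤ)) N,
          (ε.1 n : ℝ) * eigenLam (companionMatrix r σ) ^ (-n)) *
        (![ξ, -(σ : ℝ) * ξ * (eigenLam (companionMatrix r σ))⁻¹] i) : ℝ) : UnitAddCircle))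
    atTop (𝓝 (φ ε))

/-- The symbolic compactum. For `σ = -1`: digits `0, …, r`, and a digit `r` is followed by `0`.
For `σ = 1`: digits `0, …, r - 1`, and no block `(r-1) (r-2) … (r-2) (r-1)` occurs, with any
number `j ≥ 0` of digits `r - 2` in the middle. -/
def symbolicCompactum (lam : ℝ) (r : ℕ) (σ : ℤ) : Set (PrimarySet lam) :=
  {ε | (σ = -1 → ∀ n : ℤ, ε.1 n ≤ r ∧ (ε.1 n = r → ε.1 (n + 1) = 0)) ∧
    (σ = 1 → (∀ n : ℤ, ε.1 n + 1 ≤ r) ∧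
      ∀ (n : ℤ) (j : ℕ), ¬ (ε.1 n + 1 = r ∧
        (∀ i : ℕ, 1 ≤ i → i ≤ j → ε.1 (n + (i : ℤ)) + 2 = r) ∧
        ε.1 (n + (j : ℤ) + 1) + 1 = r))}

/-!
Let `c` be the conjugate of `l = λ`. In eigencoordinates, scaled by `l - c`, the torus is `ℝ²`
modulo the Minkowski embedding `x ↦ (x, x̄)` of `ℤ[l]`, and `T` multiplies the coordinates by `l`
and `c`. Modulo this lattice the divergent half of the series defining `L_ξ` is the negative of a
convergent series in powers of `c`, so `L_ξ` exists for every `ξ = (m + n l) / (l - c)`; call it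
the coding with parameter `m + n l`.

For the parameter `1`, the symbolic compactum covers the torus, because every real number in
`[0, ∞)` has a greedy expansion and the unstable half-line is dense. The compactum is recognized
by an automaton with two states, which confines the two coordinates to a union of two rectangles
whose total area is the covolume of `ℤ[l]`; hence a covering of the plane by translates of this
union overlaps only in a null set, and the coding is one-to-one almost everywhere. The coding with
parameter `m + n l` is the one with parameter `1` followed by multiplication by `m + n l` on the
torus, which is `|N(m + n l)|`-to-one.

Conversely, an equivariant additive `φ` is determined by its value at the sequence with a single
digit `1`. That value is homoclinic to `0`, so it lies on both leaves through `0`, whose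
intersection is `ℤ[l]`: `φ` is a coding. If moreover `φ` is injective on the finite sequences of a
total set `X`, then words that admit a carry are excluded from `X`, so `X` is contained in the
compactum up to sequences with a coordinate in `ℤ[l]`. Hence, if `φ` maps `X` onto the torus, so
does the coding with parameter `1` on a subset of the compactum, and uniqueness of a single
preimage forces `|N(m + n l)| = 1`. Finally the units of `ℤ[l]` are `±l^k`, except for
`(r, σ) = (3, 1)`, where `ℤ[l] = ℤ[θ]` with the golden ratio `θ`.
-/

/-! ### Units of quadratic rings -/

/-- `l > 1` and `c` are the roots of `x² - r x + σ`, in the range of parameters where `l` is an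
irrational unit. -/
structure IsQuadraticUnit (r : ℕ) (σ : ℤ) (l c : ℝ) : Prop where
  cases : (σ = -1 ∧ 1 ≤ r) ∨ (σ = 1 ∧ 3 ≤ r)
  one_lt : 1 < l
  add_eq : l + c = r
  mul_eq : l * c = σ
  irrational : Irrational l

/-- The norm of `m + n l`, where `l` is a root of `x² - r x + σ`. -/
def quadNorm (r : ℕ) (σ m n : ℤ) : ℤ := m * m + m * n * r + n * n * σ

/-- The units of the ring `ℤ[l]`, where `l` is a root of `x² - r x + σ`. -/
def quadUnits (r : ℕ) (σ : ℤ) (l : ℝ) : Set ℝ :=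
  {x | ∃ m n : ℤ, |quadNorm r σ m n| = 1 ∧ x = m + n * l}

theorem neg_mem_quadUnits {r : ℕ} {σ : ℤ} {l x : ℝ} (hx : x ∈ quadUnits r σ l) :
    -x ∈ quadUnits r σ l := by
  obtain ⟨m, n, hN, rfl⟩ := hx
  refine ⟨-m, -n, ?_, by push_cast; ring⟩
  simpa [quadNorm] using hN

theorem add_inv_lt_add_inv {u l : ℝ} (h1 : 1 < u) (h2 : u < l) : u + u⁻¹ < l + l⁻¹ := by
  have hl : 1 < l := h1.trans h2
  have hdiff : l + l⁻¹ - (u + u⁻¹) = (l - u) * (l * u - 1) / (l * u) := by field_simp; ring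
  have hpos : 0 < (l - u) * (l * u - 1) / (l * u) :=
    div_pos (mul_pos (by linarith) (by nlinarith)) (by positivity)
  linarith

theorem eq_three_of_quadNorm_eq_neg_one {r : ℕ} {m n : ℤ} (hr : 3 ≤ r) (hn : 1 ≤ n)
    (hlt : n ^ 2 * ((r : ℤ) ^ 2 - 4) < (r : ℤ) ^ 2) (hN : quadNorm r 1 m n = -1) : r = 3 := by
  obtain rfl : n = 1 := by
    by_contra hne
    have hn2 : 2 ^ 2 ≤ n ^ 2 := pow_le_pow_left₀ (by norm_num) (by omega) 2
    nlinarith [mul_le_mul_of_nonneg_right hn2 (show (0 : ℤ) ≤ (r : ℤ) ^ 2 - 4 by nlinarith)]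
  have hdvd : m ∣ 2 := ⟨-(m + r), by rw [quadNorm] at hN; linarith⟩
  have hle := Int.le_of_dvd two_pos hdvd
  have hge := Int.le_of_dvd two_pos (neg_dvd.2 hdvd)
  rw [quadNorm] at hN
  obtain rfl | rfl | rfl | rfl | rfl : m = -2 ∨ m = -1 ∨ m = 0 ∨ m = 1 ∨ m = 2 := by omega
  all_goals omega

theorem not_isSquare_discr {r : ℕ} {σ : ℤ} (h : (σ = -1 ∧ 1 ≤ r) ∨ (σ = 1 ∧ 3 ≤ r)) :
    ¬ IsSquare ((r : ℤ) ^ 2 - 4 * σ) := by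
  rintro ⟨a, ha⟩
  obtain ⟨b, hb0, hb⟩ : ∃ b : ℤ, 0 ≤ b ∧ (r : ℤ) ^ 2 - 4 * σ = b * b :=
    ⟨|a|, abs_nonneg a, by rw [ha, abs_mul_abs_self]⟩
  rcases h with ⟨rfl, h⟩ | ⟨rfl, h⟩
  · have hrb : (r : ℤ) < b := by nlinarith
    have hbr : b < (r : ℤ) + 2 := by nlinarith
    obtain rfl : b = r + 1 := by omega
    ring_nf at hb
    omega
  · have hrb : (r : ℤ) - 1 < b := by nlinarith
    have hbr : b < (r : ℤ) := by nlinarith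
    omega

namespace IsQuadraticUnit

theorem of_sqrt {r : ℕ} {σ : ℤ} (h : (σ = -1 ∧ 1 ≤ r) ∨ (σ = 1 ∧ 3 ≤ r)) :
    IsQuadraticUnit r σ ((r + √((r : ℝ) ^ 2 - 4 * σ)) / 2)
      ((r - √((r : ℝ) ^ 2 - 4 * σ)) / 2) := by
  have hD : (0 : ℤ) ≤ (r : ℤ) ^ 2 - 4 * σ := by
    rcases h with ⟨rfl, _⟩ | ⟨rfl, _⟩ <;> nlinarith
  have hsq := Real.sq_sqrt (show (0 : ℝ) ≤ (r : ℝ) ^ 2 - 4 * σ by exact_mod_cast hD)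
  have hs0 := Real.sqrt_nonneg ((r : ℝ) ^ 2 - 4 * σ)
  have hirr : Irrational √((r : ℝ) ^ 2 - 4 * σ) := by
    simpa using (irrational_sqrt_intCast_iff_of_nonneg hD).2 (not_isSquare_discr h)
  refine ⟨h, ?_, by ring, by linarith [hsq, mul_self_nonneg (r : ℝ)], ?_⟩
  · generalize √((r : ℝ) ^ 2 - 4 * σ) = t at hsq hs0
    rcases h with ⟨rfl, h⟩ | ⟨rfl, h⟩
    · have hr : (1 : ℝ) ≤ r := by exact_mod_cast h
      push_cast at hsq
      nlinarith
    · have hr : (3 : ℝ) ≤ r := by exact_mod_cast h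
      linarith
  · simpa using (hirr.natCast_add r).div_natCast (m := 2) (by norm_num)

theorem goldenRatio : IsQuadraticUnit 1 (-1) Real.goldenRatio Real.goldenConj :=
  ⟨Or.inl ⟨rfl, le_rfl⟩, Real.one_lt_goldenRatio, by simp, by simp, Real.goldenRatio_irrational⟩

variable {r : ℕ} {σ : ℤ} {l c : ℝ} (h : IsQuadraticUnit r σ l c)
include h

theorem pos : 0 < l := one_pos.trans h.one_lt

theorem sigma_eq_or : σ = -1 ∨ σ = 1 := h.cases.imp And.left And.left

theorem sigma_sq : (σ : ℝ) ^ 2 = 1 := by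
  rcases h.sigma_eq_or with rfl | rfl <;> norm_num

theorem conj_eq : c = σ / l := by
  rw [eq_div_iff h.pos.ne', mul_comm, h.mul_eq]

theorem abs_conj : |c| = 1 / l := by
  rw [h.conj_eq, abs_div, abs_of_pos h.pos]
  rcases h.sigma_eq_or with rfl | rfl <;> norm_num

theorem abs_conj_lt_one : |c| < 1 := by
  rw [h.abs_conj, div_lt_one h.pos]; exact h.one_lt

theorem sub_pos : 0 < l - c := by
  linarith [h.one_lt, (abs_lt.1 h.abs_conj_lt_one).2]

theorem conj_ne_zero : c ≠ 0 := by
  rw [← abs_pos, h.abs_conj]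
  exact one_div_pos.2 h.pos

theorem sq_eq : l ^ 2 = r * l - σ := by
  rw [← h.mul_eq, ← h.add_eq]; ring

theorem conj_sq_eq : c ^ 2 = r * c - σ := by
  rw [← h.mul_eq, ← h.add_eq]; ring

theorem conj_irrational : Irrational c := by
  have hc := h.irrational.natCast_sub r
  rwa [← h.add_eq, add_sub_cancel_left] at hc

theorem linear_ne_zero {m n : ℤ} (hmn : (m, n) ≠ (0, 0)) : (m : ℝ) + n * l ≠ 0 := by
  by_cases hn : n = 0
  · subst hn
    simpa using hmn
  · exact ((h.irrational.intCast_mul hn).intCast_add m).ne_zero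

theorem conj_linear_ne_zero {m n : ℤ} (hmn : (m, n) ≠ (0, 0)) : (m : ℝ) + n * c ≠ 0 := by
  by_cases hn : n = 0
  · subst hn
    simpa using hmn
  · exact ((h.conj_irrational.intCast_mul hn).intCast_add m).ne_zero

theorem linear_mul_conj_linear (m n : ℤ) :
    ((m : ℝ) + n * l) * (m + n * c) = quadNorm r σ m n := by
  rw [quadNorm]
  push_cast
  rw [← h.mul_eq, ← h.add_eq]
  ring

theorem exists_zpow_eq_linear (k : ℤ) : ∃ m n : ℤ, l ^ k = m + n * l ∧ c ^ k = m + n * c := by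
  have hl := h.pos.ne'
  have hc := h.conj_ne_zero
  have hσ := h.sigma_sq
  induction k with
  | zero => exact ⟨1, 0, by simp, by simp⟩
  | succ k ih =>
    obtain ⟨m, n, hm, hn⟩ := ih
    refine ⟨-n * σ, m + n * r, ?_, ?_⟩
    · rw [zpow_add_one₀ hl, hm]; push_cast; linear_combination n * h.sq_eq
    · rw [zpow_add_one₀ hc, hn]; push_cast; linear_combination n * h.conj_sq_eq
  | pred k ih =>
    obtain ⟨m, n, hm, hn⟩ := ih
    refine ⟨n + m * σ * r, -m * σ, ?_, ?_⟩
    · rw [zpow_sub_one₀ hl, hm, ← div_eq_mul_inv, div_eq_iff hl]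
      push_cast
      linear_combination (-m) * hσ + m * σ * h.sq_eq
    · rw [zpow_sub_one₀ hc, hn, ← div_eq_mul_inv, div_eq_iff hc]
      push_cast
      linear_combination (-m) * hσ + m * σ * h.conj_sq_eq

theorem zpow_mem_quadUnits (k : ℤ) : l ^ k ∈ quadUnits r σ l := by
  obtain ⟨m, n, hl, hc⟩ := h.exists_zpow_eq_linear k
  refine ⟨m, n, ?_, hl⟩
  have hN : (|quadNorm r σ m n| : ℝ) = |(σ : ℝ)| ^ k := by
    rw [← h.linear_mul_conj_linear, ← hl, ← hc, ← mul_zpow, h.mul_eq, abs_zpow]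
  have hσ : |(σ : ℝ)| = 1 := by rcases h.sigma_eq_or with rfl | rfl <;> simp
  rw [hσ, one_zpow] at hN
  exact_mod_cast hN

theorem mul_mem_quadUnits {x y : ℝ} (hx : x ∈ quadUnits r σ l) (hy : y ∈ quadUnits r σ l) :
    x * y ∈ quadUnits r σ l := by
  obtain ⟨a, b, hab, rfl⟩ := hx
  obtain ⟨m, n, hmn, rfl⟩ := hy
  refine ⟨a * m - b * n * σ, a * n + b * m + b * n * r, ?_, ?_⟩
  · have hmul : quadNorm r σ (a * m - b * n * σ) (a * n + b * m + b * n * r) =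
        quadNorm r σ a b * quadNorm r σ m n := by
      simp only [quadNorm]
      ring
    rw [hmul, abs_mul, hab, hmn, one_mul]
  · push_cast
    linear_combination (b * n) * h.sq_eq

theorem coeff_pos_of_one_lt {m n : ℤ} (hN : |quadNorm r σ m n| = 1) (h1 : 1 < (m : ℝ) + n * l) :
    1 ≤ n := by
  have hprod : |((m : ℝ) + n * l) * (m + n * c)| = 1 := by
    rw [h.linear_mul_conj_linear]; exact_mod_cast hN
  have hconj : |(m : ℝ) + n * c| < 1 := by
    rw [abs_mul, abs_of_pos (by linarith)] at hprod
    nlinarith [abs_nonneg ((m : ℝ) + n * c)]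
  have hdiff : (0 : ℝ) < n * (l - c) := by linarith [le_abs_self ((m : ℝ) + n * c)]
  have hn : (0 : ℝ) < n := pos_of_mul_pos_left hdiff h.sub_pos.le
  exact_mod_cast hn

theorem le_of_one_lt_unit (hexc : ¬ (r = 3 ∧ σ = 1)) {m n : ℤ} (hN : |quadNorm r σ m n| = 1)
    (h1 : 1 < (m : ℝ) + n * l) : l ≤ (m : ℝ) + n * l := by
  by_contra! hul
  have hn := h.coeff_pos_of_one_lt hN h1
  have hn' : (1 : ℝ) ≤ n := by exact_mod_cast hn
  have hs := h.sub_pos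
  have habs : |c| = l⁻¹ := by rw [h.abs_conj, one_div]
  have hadd := add_inv_lt_add_inv h1 hul
  have hinv := inv_strictAnti₀ (one_pos.trans h1) hul
  have hprod := h.linear_mul_conj_linear m n
  have hdiff : (m : ℝ) + n * l - (m + n * c) = n * (l - c) := by ring
  set u := (m : ℝ) + n * l
  have hu : 0 < u := one_pos.trans h1
  rcases (abs_eq zero_le_one).1 hN with hN | hN <;> rw [hN, mul_comm] at hprod <;>
    push_cast at hprod
  · rw [eq_div_of_mul_eq hu.ne' hprod, one_div] at hdiff
    nlinarith [le_abs_self c]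
  · rw [eq_div_of_mul_eq hu.ne' hprod, neg_div, one_div] at hdiff
    rcases h.cases with ⟨rfl, -⟩ | ⟨rfl, hr⟩
    · have hc : c = -l⁻¹ := by rw [h.conj_eq]; push_cast; ring
      nlinarith
    · refine hexc ⟨eq_three_of_quadNorm_eq_neg_one hr hn ?_ hN, rfl⟩
      have hc : c = l⁻¹ := by rw [h.conj_eq]; push_cast; ring
      have hlt : n * (l - c) < r := by linarith [h.add_eq]
      have hsq : (l - c) ^ 2 = (r : ℝ) ^ 2 - 4 := by
        have hmul := h.mul_eq
        push_cast at hmul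
        rw [← h.add_eq]
        linear_combination (-4) * hmul
      have hlt_sq := pow_lt_pow_left₀ hlt (by positivity) two_ne_zero
      rw [mul_pow, hsq] at hlt_sq
      exact_mod_cast hlt_sq

theorem mem_quadUnits_iff (hexc : ¬ (r = 3 ∧ σ = 1)) {x : ℝ} :
    x ∈ quadUnits r σ l ↔ ∃ (s : ℝ) (k : ℤ), (s = 1 ∨ s = -1) ∧ x = s * l ^ k := by
  have of_pos {y : ℝ} (hy : y ∈ quadUnits r σ l) (hy0 : 0 < y) : ∃ k : ℤ, y = l ^ k := by
    obtain ⟨k, hk, hk'⟩ := exists_mem_Ico_zpow hy0 h.one_lt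
    have hlk := zpow_pos h.pos k
    refine ⟨k, (div_eq_one_iff_eq hlk.ne').1 ?_⟩
    have hlt : y / l ^ k < l := by
      rwa [div_lt_iff₀ hlk, ← zpow_one_add₀ h.pos.ne', add_comm]
    obtain ⟨m, n, hN, hmn⟩ := h.mul_mem_quadUnits hy (h.zpow_mem_quadUnits (-k))
    rw [zpow_neg, ← div_eq_mul_inv] at hmn
    by_contra hne
    have h1 : 1 < y / l ^ k := lt_of_le_of_ne ((one_le_div hlk).2 hk) (Ne.symm hne)
    exact hlt.not_ge (hmn ▸ h.le_of_one_lt_unit hexc hN (hmn ▸ h1))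
  constructor
  · intro hx
    rcases lt_trichotomy x 0 with hx0 | rfl | hx0
    · obtain ⟨k, hk⟩ := of_pos (neg_mem_quadUnits hx) (neg_pos.2 hx0)
      exact ⟨-1, k, Or.inr rfl, by linarith⟩
    · obtain ⟨m, n, hN, hmn⟩ := hx
      have hN0 := h.linear_mul_conj_linear m n
      rw [← hmn, zero_mul, eq_comm, Int.cast_eq_zero] at hN0
      simp [hN0] at hN
    · obtain ⟨k, hk⟩ := of_pos hx hx0
      exact ⟨1, k, Or.inl rfl, by rw [one_mul, hk]⟩
  · rintro ⟨s, k, rfl | rfl, rfl⟩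
    · simpa using h.zpow_mem_quadUnits k
    · simpa using neg_mem_quadUnits (h.zpow_mem_quadUnits k)

end IsQuadraticUnit

theorem quadUnits_goldenRatio_add_one :
    quadUnits 3 1 (Real.goldenRatio + 1) = quadUnits 1 (-1) Real.goldenRatio := by
  have hnorm (m n : ℤ) : quadNorm 1 (-1) (m + n) n = quadNorm 3 1 m n := by
    simp only [quadNorm]
    push_cast
    ring
  ext x
  constructor
  · rintro ⟨m, n, hN, rfl⟩
    exact ⟨m + n, n, by rw [hnorm, hN], by push_cast; ring⟩
  · rintro ⟨m, n, hN, rfl⟩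
    exact ⟨m - n, n, by rw [← hnorm, sub_add_cancel, hN], by push_cast; ring⟩

/-! ### Eigencoordinates on the torus -/

/-- The point of the torus with coordinates `p.1` along the expanding eigenvector `(1, -c)` of the
companion matrix and `p.2` along the contracting eigenvector `-(1, -l)`, in units of `1 / (l - c)`.
In these units `ℤ²` becomes the Minkowski embedding of `ℤ[l]`. -/
noncomputable def eigenMk (l c : ℝ) : ℝ × ℝ →+ Torus2 where
  toFun p := ![(((p.1 - p.2) / (l - c) : ℝ) : UnitAddCircle),
    (((-c * p.1 + l * p.2) / (l - c) : ℝ) : UnitAddCircle)]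
  map_zero' := by ext i; fin_cases i <;> simp
  map_add' p q := by
    ext i
    fin_cases i
    · simp only [Fin.zero_eta, Matrix.cons_val_zero, Pi.add_apply, ← AddCircle.coe_add]
      congr 1; simp only [Prod.fst_add, Prod.snd_add]; ring
    · simp only [Fin.mk_one, Matrix.cons_val_one, Pi.add_apply, ← AddCircle.coe_add,
        Matrix.cons_val_zero]
      congr 1; simp only [Prod.fst_add, Prod.snd_add]; ring

theorem eigenMk_apply (l c : ℝ) (p : ℝ × ℝ) :
    eigenMk l c p = ![(((p.1 - p.2) / (l - c) : ℝ) : UnitAddCircle),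
      (((-c * p.1 + l * p.2) / (l - c) : ℝ) : UnitAddCircle)] := rfl

theorem continuous_eigenMk (l c : ℝ) : Continuous (eigenMk l c) := by
  have h (f : ℝ × ℝ → ℝ) (hf : Continuous f) : Continuous fun p => (f p : UnitAddCircle) :=
    (AddCircle.continuous_mk' 1).comp hf
  refine continuous_pi fun i => ?_
  fin_cases i
  · exact h _ (by fun_prop)
  · exact h _ (by fun_prop)

theorem toralMap_add (M : Matrix (Fin 2) (Fin 2) ℤ) (x y : Torus2) :
    toralMap M (x + y) = toralMap M x + toralMap M y := by
  ext i; simp [toralMap, smul_add]; abel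

/-- `toralMap` as an endomorphism of the group `Torus2`. -/
def toralHom (M : Matrix (Fin 2) (Fin 2) ℤ) : Torus2 →+ Torus2 :=
  AddMonoidHom.mk' (toralMap M) (toralMap_add M)

/-- The projection `ℝ² → ℝ² / ℤ²`. -/
def torusMk : (Fin 2 → ℝ) →+ Torus2 where
  toFun z i := z i
  map_zero' := rfl
  map_add' _ _ := rfl

theorem torusMk_apply (z : Fin 2 → ℝ) (i : Fin 2) : torusMk z i = (z i : UnitAddCircle) := rfl

theorem torusMk_surjective : Function.Surjective torusMk := fun t => by
  choose z hz using fun i => QuotientAddGroup.mk_surjective (t i)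
  exact ⟨z, funext hz⟩

theorem torusMk_eq_zero_iff (z : Fin 2 → ℝ) :
    torusMk z = 0 ↔ ∃ k : Fin 2 → ℤ, z = fun i => (k i : ℝ) := by
  simp only [funext_iff, torusMk_apply, Pi.zero_apply, AddCircle.coe_eq_zero_iff, zsmul_eq_mul,
    mul_one, Classical.skolem, @eq_comm ℝ (z _)]

theorem toralMap_torusMk (M : Matrix (Fin 2) (Fin 2) ℤ) (z : Fin 2 → ℝ) :
    toralMap M (torusMk z) = torusMk ((M.map (Int.cast : ℤ → ℝ)).mulVec z) := by
  ext i
  simp only [toralMap, torusMk_apply, Matrix.mulVec, dotProduct,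
    Matrix.map_apply, Fin.sum_univ_two, ← AddCircle.coe_zsmul, ← AddCircle.coe_add, zsmul_eq_mul]

theorem isUnit_det_map_intCast {M : Matrix (Fin 2) (Fin 2) ℤ} (hM : M.det ≠ 0) :
    IsUnit (M.map (Int.cast : ℤ → ℝ)).det := by
  rw [isUnit_iff_ne_zero, ← Int.cast_det]
  exact_mod_cast hM

theorem toralMap_surjective {M : Matrix (Fin 2) (Fin 2) ℤ} (hM : M.det ≠ 0) :
    Function.Surjective (toralMap M) := by
  intro t
  obtain ⟨z, rfl⟩ := torusMk_surjective t
  refine ⟨torusMk ((M.map Int.cast)⁻¹.mulVec z), ?_⟩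
  rw [toralMap_torusMk, Matrix.mulVec_mulVec, Matrix.mul_nonsing_inv _ (isUnit_det_map_intCast hM),
    Matrix.one_mulVec]

/-- The matrix `m + n C` where `C` is the companion matrix: multiplication by `m + n l` in
eigenvector coordinates. -/
def mulMatrix (r : ℕ) (σ m n : ℤ) : Matrix (Fin 2) (Fin 2) ℤ :=
  !![m + n * r, n; -σ * n, m]

theorem det_mulMatrix (r : ℕ) (σ m n : ℤ) : (mulMatrix r σ m n).det = quadNorm r σ m n := by
  rw [mulMatrix, Matrix.det_fin_two_of, quadNorm]; ring

theorem companionMatrix_eq (r : ℕ) (σ : ℤ) : companionMatrix r σ = mulMatrix r σ 0 1 := by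
  simp [companionMatrix, mulMatrix]

namespace IsQuadraticUnit

variable {r : ℕ} {σ : ℤ} {l c : ℝ} (h : IsQuadraticUnit r σ l c)
include h

theorem det_mulMatrix_ne_zero {m n : ℤ} (hmn : (m, n) ≠ (0, 0)) :
    (mulMatrix r σ m n).det ≠ 0 := by
  have hprod := mul_ne_zero (h.linear_ne_zero hmn) (h.conj_linear_ne_zero hmn)
  rw [h.linear_mul_conj_linear] at hprod
  rw [det_mulMatrix]
  exact_mod_cast hprod

theorem eigenMk_eq_zero_iff (p : ℝ × ℝ) :
    eigenMk l c p = 0 ↔ ∃ m n : ℤ, p = ((m : ℝ) + n * l, (m : ℝ) + n * c) := by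
  have hs := h.sub_pos.ne'
  constructor
  · intro h0
    have h1 := congrFun h0 0
    have h2 := congrFun h0 1
    simp only [eigenMk_apply, Matrix.cons_val_zero, Matrix.cons_val_one, Pi.zero_apply,
      AddCircle.coe_eq_zero_iff, zsmul_eq_mul, mul_one] at h1 h2
    obtain ⟨n, hn⟩ := h1
    obtain ⟨m, hm⟩ := h2
    rw [eq_div_iff hs] at hn hm
    refine ⟨m, n, Prod.ext ?_ ?_⟩
    · refine mul_left_cancel₀ hs ?_
      simp only; linear_combination (-l) * hn - hm
    · refine mul_left_cancel₀ hs ?_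
      simp only; linear_combination (-c) * hn - hm
  · rintro ⟨m, n, rfl⟩
    have h1 : ((m : ℝ) + n * l - (m + n * c)) / (l - c) = n := by field_simp; ring
    have h2 : (-c * ((m : ℝ) + n * l) + l * (m + n * c)) / (l - c) = m := by field_simp; ring
    ext i
    fin_cases i <;>
      simp only [eigenMk_apply, Fin.zero_eta, Fin.mk_one, Matrix.cons_val_zero, Matrix.cons_val_one,
        Pi.zero_apply, h1, h2, AddCircle.coe_eq_zero_iff, zsmul_eq_mul, mul_one]
    exacts [⟨n, rfl⟩, ⟨m, rfl⟩]

theorem eigenMk_eq_iff (p q : ℝ × ℝ) :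
    eigenMk l c p = eigenMk l c q ↔ ∃ m n : ℤ, p = q + ((m : ℝ) + n * l, (m : ℝ) + n * c) := by
  rw [← sub_eq_zero, ← map_sub, h.eigenMk_eq_zero_iff]
  simp only [sub_eq_iff_eq_add']

theorem eigenMk_eq_torusMk (z : Fin 2 → ℝ) :
    eigenMk l c (l * z 0 + z 1, c * z 0 + z 1) = torusMk z := by
  have hs := h.sub_pos.ne'
  ext i
  fin_cases i <;> simp only [eigenMk_apply, Fin.zero_eta, Fin.mk_one, Matrix.cons_val_zero,
    Matrix.cons_val_one, torusMk_apply] <;> congr 1 <;>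
    field_simp <;> ring

theorem eigenMk_surjective : Function.Surjective (eigenMk l c) := fun t => by
  obtain ⟨z, rfl⟩ := torusMk_surjective t
  exact ⟨_, h.eigenMk_eq_torusMk z⟩

theorem toralMap_mulMatrix (m n : ℤ) (p : ℝ × ℝ) :
    toralMap (mulMatrix r σ m n) (eigenMk l c p) =
      eigenMk l c (((m : ℝ) + n * l) * p.1, ((m : ℝ) + n * c) * p.2) := by
  have hp : eigenMk l c p =
      torusMk ![(p.1 - p.2) / (l - c), (-c * p.1 + l * p.2) / (l - c)] := by
    ext i; fin_cases i <;> rfl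
  rw [hp, toralMap_torusMk]
  have hm := h.mul_eq
  have ha := h.add_eq
  ext i
  fin_cases i <;>
    simp only [eigenMk_apply, torusMk_apply, Matrix.mulVec,
      dotProduct, Fin.sum_univ_two, mulMatrix, Matrix.map_apply, Fin.zero_eta, Fin.mk_one,
      Matrix.of_apply, Matrix.cons_val_zero, Matrix.cons_val_one] <;>
    congr 1 <;> push_cast
  · rw [← ha]; ring
  · rw [← hm]; ring

theorem toralMap_companionMatrix (p : ℝ × ℝ) :
    toralMap (companionMatrix r σ) (eigenMk l c p) = eigenMk l c (l * p.1, c * p.2) := by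
  rw [companionMatrix_eq, h.toralMap_mulMatrix]; simp

theorem iterate_toralMap_companionMatrix (k : ℕ) (p : ℝ × ℝ) :
    (toralMap (companionMatrix r σ))^[k] (eigenMk l c p) =
      eigenMk l c (l ^ k * p.1, c ^ k * p.2) := by
  induction k with
  | zero => simp
  | succ k ih =>
    rw [Function.iterate_succ_apply', ih, h.toralMap_companionMatrix]
    congr 2 <;> (simp only; ring)

theorem dense_unstable_halfLine : Dense ((fun x : ℝ => eigenMk l c (x, 0)) '' Set.Ici 0) := by
  have hs := h.sub_pos
  have hd : DenseRange fun n : ℕ => n • ((-c : ℝ) : UnitAddCircle) :=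
    denseRange_zsmul_iff_nsmul.1
      (AddCircle.denseRange_zsmul_coe_iff.2 (by simpa using h.conj_irrational))
  intro t
  obtain ⟨u, hu0, hu⟩ : ∃ u : ℝ, 0 ≤ u ∧ (u : UnitAddCircle) = t 0 := by
    obtain ⟨a, ha⟩ := QuotientAddGroup.mk_surjective (t 0)
    exact ⟨Int.fract a, Int.fract_nonneg a, ha ▸ AddCircle.coe_fract a⟩
  -- The half-line returns to the vertical circle through `t` along the orbit of an irrational
  -- rotation.
  let circle : UnitAddCircle → Torus2 := fun a => ![t 0, a - ((c * u : ℝ) : UnitAddCircle)]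
  have hcircle : Continuous circle := by
    refine continuous_pi fun i => ?_
    fin_cases i
    · exact continuous_const
    · exact continuous_id.sub continuous_const
  have ht : t = circle (t 1 + ((c * u : ℝ) : UnitAddCircle)) := by
    ext i; fin_cases i <;> simp [circle]
  rw [ht]
  refine map_mem_closure hcircle (hd (t 1 + ((c * u : ℝ) : UnitAddCircle))) ?_
  rintro _ ⟨n, rfl⟩
  refine ⟨(l - c) * (u + n), Set.mem_Ici.2 (by positivity), ?_⟩
  ext i
  fin_cases i
  · simp only [circle, eigenMk_apply, Fin.zero_eta, Matrix.cons_val_zero, sub_zero, ← hu]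
    rw [mul_div_cancel_left₀ _ hs.ne', AddCircle.coe_add,
      (AddCircle.coe_eq_zero_iff 1 (x := (n : ℝ))).2 ⟨(n : ℤ), by simp⟩, add_zero]
  · simp only [circle, eigenMk_apply, Fin.mk_one, Matrix.cons_val_one, ← AddCircle.coe_nsmul,
      ← AddCircle.coe_sub]
    rw [show (-c * ((l - c) * (u + n)) + l * 0) / (l - c) = n • (-c) - c * u by
      rw [nsmul_eq_mul]; field_simp; ring]

theorem exists_unstable_line_subset {F : Set Torus2} (hF : IsClosed F)
    (hT : Set.MapsTo (toralMap (companionMatrix r σ)) F F) (hi : (interior F).Nonempty) :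
    ∃ p, ∀ u : ℝ, p + eigenMk l c (u, 0) ∈ F := by
  obtain ⟨t, ht⟩ := hi
  obtain ⟨⟨x, y⟩, rfl⟩ := h.eigenMk_surjective t
  have hl := h.pos
  have hev : ∀ᶠ u in 𝓝 (0 : ℝ), eigenMk l c (x + u, y) ∈ F := by
    have hc : Continuous fun u : ℝ => eigenMk l c (x + u, y) :=
      (continuous_eigenMk l c).comp (by fun_prop)
    refine hc.continuousAt.eventually_mem ?_
    simpa using mem_interior_iff_mem_nhds.1 ht
  obtain ⟨p, φ, hφ, hp⟩ := CompactSpace.tendsto_subseq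
    fun k : ℕ => (toralMap (companionMatrix r σ))^[k] (eigenMk l c (x, y))
  refine ⟨p, fun u => ?_⟩
  have hshrink : Tendsto (fun k => u * (l⁻¹) ^ (φ k)) atTop (𝓝 0) := by
    have hpow := (tendsto_pow_atTop_nhds_zero_of_lt_one (inv_nonneg.2 hl.le)
      (inv_lt_one_of_one_lt₀ h.one_lt)).comp hφ.tendsto_atTop
    simpa using hpow.const_mul u
  refine hF.mem_of_tendsto (hp.add_const (eigenMk l c (u, 0))) ?_
  filter_upwards [hshrink.eventually hev] with k hk
  convert hT.iterate (φ k) hk using 1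
  simp only [Function.comp, h.iterate_toralMap_companionMatrix, ← map_add]
  congr 1
  ext
  · simp only [inv_pow, Prod.mk_add_mk]; field_simp
  · simp

theorem eq_univ_of_interior_nonempty {F : Set Torus2} (hF : IsClosed F)
    (hT : Set.MapsTo (toralMap (companionMatrix r σ)) F F) (hi : (interior F).Nonempty) :
    F = Set.univ := by
  obtain ⟨p, hp⟩ := h.exists_unstable_line_subset hF hT hi
  refine Set.eq_univ_of_forall fun t => ?_
  have hmem := map_mem_closure (continuous_const_add p) (h.dense_unstable_halfLine (t - p)) (t := F)
    (by rintro _ ⟨u, -, rfl⟩; exact hp u)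
  simpa [hF.closure_eq] using hmem

end IsQuadraticUnit

/-! ### The codings -/

theorem reflect_mem {l : ℝ} {ε : ℤ → ℕ} (hε : ε ∈ PrimarySet l) :
    (fun n => ε (-n)) ∈ PrimarySet l :=
  ⟨hε.2, by simpa using hε.1⟩

theorem unshift_mem {l : ℝ} {ε : ℤ → ℕ} (hε : ε ∈ PrimarySet l) :
    (fun n => ε (n - 1)) ∈ PrimarySet l := by
  convert reflect_mem (shift_mem ⟨_, reflect_mem hε⟩) using 3
  ring

theorem translate_mem {l : ℝ} {ε : ℤ → ℕ} (hε : ε ∈ PrimarySet l) (n : ℤ) :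
    (fun k => ε (k + n)) ∈ PrimarySet l := by
  induction n with
  | zero => simpa using hε
  | succ n ih =>
    convert shift_mem ⟨_, ih⟩ using 3
    ring
  | pred n ih =>
    convert unshift_mem ih using 3
    ring

theorem mem_of_finite_support {l : ℝ} {ε : ℤ → ℕ} (hε : (Function.support ε).Finite) :
    ε ∈ PrimarySet l := by
  have summable_digits (f : ℕ → ℤ) (hf : Function.Injective f) :
      Summable fun n : ℕ => (ε (f n) : ℝ) / l ^ (n + 1) := by
    refine summable_of_hasFiniteSupport ((hε.preimage hf.injOn).subset fun n hn => ?_)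
    simp only [Function.mem_support, Set.mem_preimage] at hn ⊢
    intro h0; simp [h0] at hn
  exact ⟨summable_digits (fun n => (n : ℤ) + 1) fun a b hab => by simpa using hab,
    summable_digits (fun n => -((n : ℤ) + 1)) fun a b hab => by simpa using hab⟩

theorem mem_of_bounded {l : ℝ} (hl : 1 < l) {ε : ℤ → ℕ} {b : ℕ} (hε : ∀ n, ε n ≤ b) :
    ε ∈ PrimarySet l := by
  have hl0 : 0 < l := by linarith
  have summable_digits (f : ℕ → ℤ) : Summable fun n : ℕ => (ε (f n) : ℝ) / l ^ (n + 1) := by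
    have hs : Summable fun n : ℕ => (b : ℝ) * (l⁻¹) ^ (n + 1) :=
      ((summable_nat_add_iff 1).2 (summable_geometric_of_lt_one (inv_nonneg.2 hl0.le)
        (inv_lt_one_of_one_lt₀ hl))).mul_left _
    refine hs.of_nonneg_of_le (fun n => by positivity) fun n => ?_
    rw [inv_pow, ← div_eq_mul_inv]
    gcongr
    exact hε _
  exact ⟨summable_digits _, summable_digits _⟩

/-- The contracting half `∑_{k ≥ 1} ε_{n+k} l^{-k}` of the expansion of `ε` seen from place `n`. -/
noncomputable def fut (l : ℝ) (ε : ℤ → ℕ) (n : ℤ) : ℝ :=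
  ∑' k : ℕ, (ε (n + (k + 1)) : ℝ) / l ^ (k + 1)

/-- The expanding half of the expansion of `ε` seen from place `n`, made convergent by replacing `l`
with its conjugate `c`: the sum `∑_{k ≥ 0} ε_{n-k} c^k`. -/
noncomputable def past (c : ℝ) (ε : ℤ → ℕ) (n : ℤ) : ℝ :=
  ∑' k : ℕ, (ε (n - k) : ℝ) * c ^ k

theorem summable_fut {l : ℝ} {ε : ℤ → ℕ} (hε : ε ∈ PrimarySet l) (n : ℤ) :
    Summable fun k : ℕ => (ε (n + (k + 1)) : ℝ) / l ^ (k + 1) := by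
  refine (translate_mem hε n).1.congr fun k => ?_
  rw [add_comm n]

theorem fut_shift {l : ℝ} (ε : PrimarySet l) (n : ℤ) :
    fut l (shift ε).1 n = fut l ε.1 (n + 1) := by
  refine tsum_congr fun k => ?_
  simp only [shift]
  rw [show n + ((k : ℤ) + 1) + 1 = n + 1 + (k + 1) by ring]

theorem past_shift {l : ℝ} (c : ℝ) (ε : PrimarySet l) (n : ℤ) :
    past c (shift ε).1 n = past c ε.1 (n + 1) := by
  refine tsum_congr fun k => ?_
  simp only [shift]
  rw [show n - (k : ℤ) + 1 = n + 1 - k by ring]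

theorem fut_rec {l : ℝ} (hl : l ≠ 0) {ε : ℤ → ℕ} (hε : ε ∈ PrimarySet l) (n : ℤ) :
    l * fut l ε n = ε (n + 1) + fut l ε (n + 1) := by
  unfold fut
  rw [(summable_fut hε n).tsum_eq_zero_add, mul_add, ← tsum_mul_left]
  congr 1
  · simp only [Nat.cast_zero, zero_add, pow_one]; field_simp
  · refine tsum_congr fun k => ?_
    rw [pow_succ l (k + 1)]
    push_cast
    rw [show n + ((k : ℤ) + 1 + 1) = n + 1 + (k + 1) by ring]
    field_simp

theorem fut_nonneg {l : ℝ} (hl : 0 < l) (ε : ℤ → ℕ) (n : ℤ) : 0 ≤ fut l ε n :=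
  tsum_nonneg fun _ => by positivity

theorem fut_add {l : ℝ} {ε ε' : ℤ → ℕ} (hε : ε ∈ PrimarySet l) (hε' : ε' ∈ PrimarySet l) (n : ℤ) :
    fut l (ε + ε') n = fut l ε n + fut l ε' n := by
  unfold fut
  rw [← (summable_fut hε n).tsum_add (summable_fut hε' n)]
  refine tsum_congr fun k => ?_
  simp [add_div]

/-- The map `L_ξ` for `ξ = (m + n l) / (l - c)`. As `((m + n l) l^k, (m + n c) c^k)` lies in the
Minkowski lattice, the divergent half of the series along the expanding direction is the negative of
a convergent one along the contracting direction. -/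
noncomputable def coding (l c : ℝ) (m n : ℤ) (ε : PrimarySet l) : Torus2 :=
  eigenMk l c ((m + n * l) * fut l ε.1 0, -((m + n * c) * past c ε.1 0))

theorem continuous_digit {l : ℝ} (n : ℤ) : Continuous fun ε : PrimarySet l => (ε.1 n : ℝ) :=
  continuous_of_discreteTopology.comp ((continuous_apply n).comp continuous_subtype_val)

namespace IsQuadraticUnit

variable {r : ℕ} {σ : ℤ} {l c : ℝ} (h : IsQuadraticUnit r σ l c)
include h

theorem summable_past {ε : ℤ → ℕ} (hε : ε ∈ PrimarySet l) (n : ℤ) :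
    Summable fun k : ℕ => (ε (n - k) : ℝ) * c ^ k := by
  refine (summable_nat_add_iff 1).1 (((translate_mem hε n).2).of_norm_bounded fun k => ?_)
  rw [norm_mul, norm_pow, Real.norm_eq_abs, Real.norm_eq_abs, h.abs_conj, Nat.abs_cast,
    one_div_pow, mul_one_div]
  refine le_of_eq ?_
  congr 3
  push_cast; ring

theorem past_rec {ε : ℤ → ℕ} (hε : ε ∈ PrimarySet l) (n : ℤ) :
    past c ε (n + 1) = ε (n + 1) + c * past c ε n := by
  unfold past
  rw [(h.summable_past hε (n + 1)).tsum_eq_zero_add, ← tsum_mul_left]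
  congr 1
  · simp
  · refine tsum_congr fun k => ?_
    rw [show n + 1 - ((k + 1 : ℕ) : ℤ) = n - k by push_cast; ring]
    ring

theorem past_add {ε ε' : ℤ → ℕ} (hε : ε ∈ PrimarySet l) (hε' : ε' ∈ PrimarySet l) (n : ℤ) :
    past c (ε + ε') n = past c ε n + past c ε' n := by
  unfold past
  rw [← (h.summable_past hε n).tsum_add (h.summable_past hε' n)]
  refine tsum_congr fun k => ?_
  simp [add_mul]

theorem coding_add (m n : ℤ) (ε ε' : PrimarySet l) :
    coding l c m n (ε + ε') = coding l c m n ε + coding l c m n ε' := by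
  unfold coding
  rw [← map_add, AddSubmonoid.coe_add, fut_add ε.2 ε'.2, h.past_add ε.2 ε'.2]
  congr 1; ext <;> simp <;> ring

theorem coding_shift (m n : ℤ) (ε : PrimarySet l) :
    coding l c m n (shift ε) = toralMap (companionMatrix r σ) (coding l c m n ε) := by
  unfold coding
  rw [h.toralMap_companionMatrix, fut_shift, past_shift, h.eigenMk_eq_iff, h.past_rec ε.2 0]
  refine ⟨-ε.1 (0 + 1) * m, -ε.1 (0 + 1) * n, ?_⟩
  have hfut := fut_rec h.pos.ne' ε.2 0
  simp only [zero_add] at hfut ⊢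
  ext
  · push_cast; simp only [Prod.mk_add_mk]
    linear_combination (-(m + n * l)) * hfut
  · push_cast; simp only [Prod.mk_add_mk]; ring

theorem coding_eq_toralMap (m n : ℤ) (ε : PrimarySet l) :
    coding l c m n ε = toralMap (mulMatrix r σ m n) (coding l c 1 0 ε) := by
  unfold coding
  rw [h.toralMap_mulMatrix]
  simp

theorem continuousOn_coding (m n : ℤ) (w : PrimarySet l) :
    ContinuousOn (coding l c m n) {ε | ∀ n, ε.1 n ≤ w.1 n} := by
  have hfut : ContinuousOn (fun ε : PrimarySet l => fut l ε.1 0) {ε | ∀ n, ε.1 n ≤ w.1 n} := by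
    refine continuousOn_tsum (fun k => ((continuous_digit _).div_const _).continuousOn)
      (summable_fut w.2 0) fun k ε hε => ?_
    have hl := h.pos
    rw [Real.norm_of_nonneg (by positivity)]
    gcongr
    exact hε _
  have hpast : ContinuousOn (fun ε : PrimarySet l => past c ε.1 0) {ε | ∀ n, ε.1 n ≤ w.1 n} := by
    refine continuousOn_tsum (fun k => ((continuous_digit _).mul_const _).continuousOn)
      (h.summable_past w.2 0).norm fun k ε hε => ?_
    simp only [norm_mul, Real.norm_natCast]
    gcongr
    exact hε _
  exact (continuous_eigenMk l c).comp_continuousOn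
    ((hfut.const_mul _).prodMk ((hpast.const_mul _).neg))

theorem eigenMk_mul_zpow (m n k : ℤ) (a : ℕ) :
    eigenMk l c ((m + n * l) * (a * l ^ k), 0) =
      eigenMk l c (0, -((m + n * c) * (a * c ^ k))) := by
  obtain ⟨i, j, hi, hj⟩ := h.exists_zpow_eq_linear k
  have hunit : eigenMk l c (a * l ^ k, a * c ^ k) = 0 :=
    (h.eigenMk_eq_zero_iff _).2 ⟨a * i, a * j, by
      rw [hi, hj]; push_cast; ext <;> simp only <;> ring⟩
  have hmul := h.toralMap_mulMatrix m n (a * l ^ k, a * c ^ k)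
  rw [hunit, show toralMap (mulMatrix r σ m n) 0 = 0 from (toralHom _).map_zero] at hmul
  rw [← sub_eq_zero, ← map_sub, hmul]
  congr 1; ext <;> simp

theorem eigenMk_partialSum (m n : ℤ) (ε : ℤ → ℕ) (N : ℕ) :
    eigenMk l c ((m + n * l) * ∑ k ∈ Finset.Icc (-(N : ℤ)) N, (ε k : ℝ) * l ^ (-k), 0) =
      eigenMk l c ((m + n * l) * ∑ k ∈ Finset.range N, (ε (0 + (k + 1)) : ℝ) / l ^ (k + 1),
        -((m + n * c) * ∑ k ∈ Finset.range (N + 1), (ε (0 - k) : ℝ) * c ^ k)) := by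
  induction N with
  | zero => simpa using h.eigenMk_mul_zpow m n 0 (ε 0)
  | succ N ih =>
    have hpow (x : ℝ) : x ^ ((N : ℤ) + 1) = x ^ (N + 1) := by exact_mod_cast zpow_natCast x (N + 1)
    have hset : Finset.Icc (-((N + 1 : ℕ) : ℤ)) (N + 1 : ℕ) =
        insert ((N : ℤ) + 1) (insert (-((N : ℤ) + 1)) (Finset.Icc (-(N : ℤ)) N)) := by
      ext k; simp only [Finset.mem_Icc, Finset.mem_insert]; push_cast; omega
    have hsplit : ((m + n * l) * ∑ k ∈ Finset.Icc (-((N + 1 : ℕ) : ℤ)) (N + 1 : ℕ),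
        (ε k : ℝ) * l ^ (-k), (0 : ℝ)) =
        ((m + n * l) * ((ε (N + 1) : ℝ) / l ^ (N + 1)), 0) +
        (((m + n * l) * ((ε (-(N + 1)) : ℝ) * l ^ ((N : ℤ) + 1)), 0) +
        ((m + n * l) * ∑ k ∈ Finset.Icc (-(N : ℤ)) N, (ε k : ℝ) * l ^ (-k), 0)) := by
      rw [hset, Finset.sum_insert (by simp; omega), Finset.sum_insert (by simp)]
      ext
      · simp only [Prod.mk_add_mk, zpow_neg, neg_neg, hpow l]
        ring
      · simp
    rw [hsplit, map_add, map_add, ih, h.eigenMk_mul_zpow, ← map_add, ← map_add]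
    conv_rhs => rw [Finset.sum_range_succ, Finset.sum_range_succ]
    congr 1
    ext
    · simp only [neg_add_rev, zero_add, zero_sub, Prod.mk_add_mk]; ring
    · simp only [neg_add_rev, hpow c, zero_add, zero_sub, Prod.mk_add_mk, Nat.cast_add,
        Nat.cast_one]
      ring

theorem tendsto_coding (m n : ℤ) (ε : PrimarySet l) :
    Tendsto (fun N : ℕ => eigenMk l c
      ((m + n * l) * ∑ k ∈ Finset.Icc (-(N : ℤ)) N, (ε.1 k : ℝ) * l ^ (-k), 0)) atTop
      (𝓝 (coding l c m n ε)) := by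
  simp only [h.eigenMk_partialSum]
  refine ((continuous_eigenMk l c).tendsto _).comp ?_
  refine Tendsto.prodMk_nhds ?_ ?_
  · exact (summable_fut ε.2 0).hasSum.tendsto_sum_nat.const_mul _
  · exact (((h.summable_past ε.2 0).hasSum.tendsto_sum_nat.comp
      (tendsto_add_atTop_nat 1)).const_mul _).neg

theorem toralMap_companionMatrix_injective :
    Function.Injective (toralMap (companionMatrix r σ)) := by
  obtain ⟨m, n, hl, hc⟩ := h.exists_zpow_eq_linear (-1)
  refine Function.LeftInverse.injective (g := toralMap (mulMatrix r σ m n)) fun t => ?_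
  obtain ⟨p, rfl⟩ := h.eigenMk_surjective t
  rw [h.toralMap_companionMatrix, h.toralMap_mulMatrix, ← hl, ← hc]
  simp [h.pos.ne', h.conj_ne_zero]

end IsQuadraticUnit

/-! ### The symbolic compactum -/

theorem isClosed_digits {l : ℝ} (s : ℤ) (P : ℕ → Prop) : IsClosed {ε : PrimarySet l | P (ε.1 s)} :=
  (isClosed_discrete {a | P a}).preimage ((continuous_apply s).comp continuous_subtype_val)

theorem isOpen_digits {l : ℝ} (s : ℤ) (P : ℕ → Prop) : IsOpen {ε : PrimarySet l | P (ε.1 s)} :=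
  (isOpen_discrete {a | P a}).preimage ((continuous_apply s).comp continuous_subtype_val)

theorem isClosed_symbolicCompactum (l : ℝ) (r : ℕ) (σ : ℤ) :
    IsClosed (symbolicCompactum l r σ) := by
  simp only [symbolicCompactum, Set.ofPred_and, Set.ofPred_forall]
  refine (isClosed_iInter fun _ => isClosed_iInter fun n => ?_).inter
    (isClosed_iInter fun _ => (isClosed_iInter fun n => isClosed_digits n (· + 1 ≤ r)).inter
      (isClosed_iInter fun n => isClosed_iInter fun j => ?_))
  · exact (isClosed_digits n (· ≤ r)).inter
      (isClosed_imp (isOpen_digits n (· = r)) (isClosed_digits (n + 1) (· = 0)))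
  · have hmiddle : IsOpen {ε : PrimarySet l | ∀ i : ℕ, 1 ≤ i → i ≤ j → ε.1 (n + i) + 2 = r} := by
      convert isOpen_biInter_finset (s := Finset.Icc 1 j) fun i _ =>
        isOpen_digits (l := l) (n + (i : ℤ)) (· + 2 = r) using 1
      ext ε; simp
    exact ((isOpen_digits n (· + 1 = r)).inter
      (hmiddle.inter (isOpen_digits (n + j + 1) (· + 1 = r)))).isClosed_compl

theorem shift_mem_symbolicCompactum {l : ℝ} {r : ℕ} {σ : ℤ} (ε : PrimarySet l) :
    shift ε ∈ symbolicCompactum l r σ ↔ ε ∈ symbolicCompactum l r σ := by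
  have hsurj := add_right_surjective (1 : ℤ)
  refine and_congr (imp_congr_right fun _ => (hsurj.forall
      (p := fun n => ε.1 n ≤ r ∧ (ε.1 n = r → ε.1 (n + 1) = 0))).symm)
    (imp_congr_right fun _ => and_congr (hsurj.forall (p := fun n => ε.1 n + 1 ≤ r)).symm ?_)
  conv_rhs => rw [hsurj.forall]
  simp only [shift, add_right_comm _ _ (1 : ℤ)]

theorem LexLess.head_le {a b : ℕ → ℕ} (hab : LexLess a b) : a 0 ≤ b 0 := by
  obtain ⟨n, hn, heq⟩ := hab
  rcases n.eq_zero_or_pos with rfl | hpos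
  exacts [hn.le, (heq 0 hpos).le]

theorem LexLess.second_eq_zero {a b : ℕ → ℕ} (hab : LexLess a b) (h0 : a 0 = b 0) (hb : b 1 = 0) :
    a 1 = 0 := by
  obtain ⟨n, hn, heq⟩ := hab
  match n with
  | 0 => omega
  | 1 => omega
  | n + 2 => rw [heq 1 (by omega), hb]

theorem LexLess.not_block {a b : ℕ → ℕ} {r : ℕ} (hab : LexLess a b) (hle : ∀ n, b n + 1 ≤ r)
    (hb : ∀ j, ¬ (b 0 + 1 = r ∧ (∀ i, 1 ≤ i → i ≤ j → b i + 2 = r) ∧ b (j + 1) + 1 = r)) (j : ℕ) :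
    ¬ (a 0 + 1 = r ∧ (∀ i, 1 ≤ i → i ≤ j → a i + 2 = r) ∧ a (j + 1) + 1 = r) := by
  rintro ⟨hfirst, hmiddle, hlast⟩
  obtain ⟨m, hm, heq⟩ := hab
  have hbm := hle m
  have hmiddle' (i : ℕ) (hi : 1 ≤ i) (hij : i ≤ j) (him : i < m) : b i + 2 = r := by
    rw [← heq i him]; exact hmiddle i hi hij
  have hm0 : m ≠ 0 := by rintro rfl; omega
  have hb0 : b 0 + 1 = r := by rw [← heq 0 (by omega), hfirst]
  rcases lt_trichotomy m (j + 1) with hmj | rfl | hmj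
  · have ham := hmiddle m (by omega) (by omega)
    refine hb (m - 1) ⟨hb0, fun i hi hij => hmiddle' i hi (by omega) (by omega), ?_⟩
    rw [show m - 1 + 1 = m by omega]; omega
  · omega
  · exact hb j ⟨hb0, fun i hi hij => hmiddle' i hi hij (by omega), by rw [← heq _ hmj, hlast]⟩

theorem isTotalSet_symbolicCompactum (l : ℝ) (r : ℕ) (σ : ℤ) :
    IsTotalSet (symbolicCompactum l r σ) := by
  rintro ε ⟨hneg, hpos⟩ ε' ⟨N, hN⟩
  have hle (k : ℤ) : ε'.1 k ≤ ε.1 N := by simpa using (hN k).head_le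
  refine ⟨fun hσ n => ?_, fun hσ => ⟨fun n => ?_, fun n j => ?_⟩⟩
  · obtain ⟨hNr, hnext⟩ := hneg hσ N
    refine ⟨(hle n).trans hNr, fun hr => ?_⟩
    have heq : ε.1 N = r := le_antisymm hNr (hr ▸ hle n)
    simpa using (hN n).second_eq_zero (by simp [hr, heq]) (by simpa using hnext heq)
  · exact (Nat.add_le_add_right (hle n) 1).trans ((hpos hσ).1 N)
  · simpa [add_assoc] using (hN n).not_block (fun i => (hpos hσ).1 _)
      (fun j => by simpa [add_assoc] using (hpos hσ).2 N j) j

/-- The constant sequence `b`, the dominating sequence on the symbolic compactum. -/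
def constSeq {l : ℝ} (hl : 1 < l) (b : ℕ) : PrimarySet l :=
  ⟨fun _ => b, mem_of_bounded hl fun _ => le_rfl⟩

theorem isCompact_le_const {l : ℝ} (hl : 1 < l) (b : ℕ) :
    IsCompact {ε : PrimarySet l | ∀ n, ε.1 n ≤ b} := by
  rw [Topology.IsInducing.subtypeVal.isCompact_iff]
  have himage : (Subtype.val '' {ε : PrimarySet l | ∀ n, ε.1 n ≤ b} : Set (ℤ → ℕ)) =
      Set.univ.pi fun _ => Set.Iic b := by
    ext ε
    simp only [Set.mem_image, Set.mem_ofPred_eq, Set.mem_univ_pi, Set.mem_Iic]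
    constructor
    · rintro ⟨ε, hε, rfl⟩; exact hε
    · exact fun hε => ⟨⟨ε, mem_of_bounded hl hε⟩, hε, rfl⟩
  exact himage ▸ isCompact_univ_pi fun _ => (Set.finite_Iic b).isCompact

/-- A labelling of the positions of `ε` by the two states of the automaton that recognizes the
symbolic compactum: `q n` says that the digit at `n + 1` is subject to the stronger bound. -/
structure IsLabelling (r : ℕ) (σ : ℤ) (ε : ℤ → ℕ) (q : ℤ → Prop) : Prop where
  neg : σ = -1 → ∀ n, ε n ≤ r ∧ (q n ↔ ε n = r) ∧ (q n → ε (n + 1) = 0)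
  pos_free : σ = 1 → ∀ n, ¬ q n → ε (n + 1) + 1 ≤ r ∧ (q (n + 1) ↔ ε (n + 1) + 1 = r)
  pos_bound : σ = 1 → ∀ n, q n → ε (n + 1) + 2 ≤ r ∧ (q (n + 1) ↔ ε (n + 1) + 2 = r)

/-- The digits of `ε` up to place `n` end with `(r-1) (r-2)^j` for some `j`: the second digit `r-1`
of a forbidden block cannot come next. -/
def EndsWithOpenBlock (r : ℕ) (ε : ℤ → ℕ) (n : ℤ) : Prop :=
  ∃ j : ℕ, ε (n - j) + 1 = r ∧ ∀ i < j, ε (n - i) + 2 = r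

theorem endsWithOpenBlock_succ_iff {r : ℕ} {ε : ℤ → ℕ} {n : ℤ} :
    EndsWithOpenBlock r ε (n + 1) ↔
      ε (n + 1) + 1 = r ∨ (ε (n + 1) + 2 = r ∧ EndsWithOpenBlock r ε n) := by
  have hsub (i : ℕ) : n + 1 - ((i + 1 : ℕ) : ℤ) = n - i := by push_cast; ring
  constructor
  · rintro ⟨_ | j, hfirst, hmiddle⟩
    · exact Or.inl (by simpa using hfirst)
    · refine Or.inr ⟨by simpa using hmiddle 0 (by omega), j, hsub j ▸ hfirst, fun i hi => ?_⟩
      exact hsub i ▸ hmiddle (i + 1) (by omega)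
  · rintro (hlast | ⟨hlast, j, hfirst, hmiddle⟩)
    · exact ⟨0, by simpa using hlast, by simp⟩
    · refine ⟨j + 1, (hsub j).symm ▸ hfirst, fun i hi => ?_⟩
      cases i with
      | zero => simpa using hlast
      | succ i => exact (hsub i).symm ▸ hmiddle i (by omega)

theorem exists_labelling {l : ℝ} {r : ℕ} {σ : ℤ} (hσ : σ = -1 ∨ σ = 1) {ε : PrimarySet l}
    (hε : ε ∈ symbolicCompactum l r σ) : ∃ q, IsLabelling r σ ε.1 q := by
  rcases hσ with rfl | rfl
  · refine ⟨fun n => ε.1 n = r, fun _ n => ?_, fun h => by simp at h, fun h => by simp at h⟩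
    obtain ⟨hle, hnext⟩ := hε.1 rfl n
    exact ⟨hle, Iff.rfl, hnext⟩
  · obtain ⟨hle, hblock⟩ := hε.2 rfl
    refine ⟨EndsWithOpenBlock r ε.1, fun h => by simp at h, fun _ n hq => ⟨hle _, ?_⟩,
      fun _ n hq => ?_⟩
    · simp [endsWithOpenBlock_succ_iff, hq]
    · have hne : ε.1 (n + 1) + 1 ≠ r := by
        obtain ⟨j, hfirst, hmiddle⟩ := hq
        intro hlast
        refine hblock (n - j) j ⟨hfirst, fun i hi hij => ?_, by simpa using hlast⟩
        rw [← hmiddle (j - i) (by omega), Nat.cast_sub hij]; ring_nf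
      have hlast := hle (n + 1)
      exact ⟨by omega, by simp [endsWithOpenBlock_succ_iff, hq, hne]⟩

theorem nonpos_of_contraction {e : ℕ → ℝ} {q M : ℝ} (hq0 : 0 ≤ q) (hq1 : q < 1)
    (hM : ∀ k, e k ≤ M) (he : ∀ k, e k ≤ q * e (k + 1)) : e 0 ≤ 0 := by
  have hiter (k : ℕ) : e 0 ≤ q ^ k * e k := by
    induction k with
    | zero => simp
    | succ k ih =>
      calc e 0 ≤ q ^ k * e k := ih
        _ ≤ q ^ k * (q * e (k + 1)) := by gcongr; exact he k
        _ = q ^ (k + 1) * e (k + 1) := by ring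
  have hlim : Tendsto (fun k : ℕ => q ^ k * M) atTop (𝓝 0) := by
    simpa using (tendsto_pow_atTop_nhds_zero_of_lt_one hq0 hq1).mul_const M
  exact ge_of_tendsto' hlim fun k => (hiter k).trans (by gcongr; exact hM k)

theorem fut_le_of_bounded {l : ℝ} (hl : 1 < l) {ε : ℤ → ℕ} {b : ℕ} (hε : ∀ n, ε n ≤ b) (n : ℤ) :
    fut l ε n ≤ fut l (fun _ => b) 0 := by
  refine (summable_fut (mem_of_bounded hl hε) n).tsum_le_tsum (fun k => ?_)
    (summable_fut (mem_of_bounded hl fun _ => le_rfl) 0)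
  gcongr
  exact hε _

open scoped Classical in
/-- The bound on `fut` in each state of the automaton. -/
noncomputable def futBound (σ : ℤ) (c : ℝ) (q : Prop) : ℝ := if q then (1 + σ) / 2 - c else 1

open scoped Classical in
/-- The lower bound on `past` in each state of the automaton. -/
noncomputable def pastLower (σ : ℤ) (l : ℝ) (q : Prop) : ℝ := if q then l - 1 else (σ - 1) / 2

open scoped Classical in
/-- The upper bound on `past` in each state of the automaton. -/
noncomputable def pastUpper (l : ℝ) (q : Prop) : ℝ := if q then l else l - 1

/-- The amount `-c` if `σ = -1`, and `1` if `σ = 1`, such that the values of `past` at a digit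
`d ≥ 1` lie in `[d - 1 + pastEdge σ c, d + pastEdge σ c]`. -/
noncomputable def pastEdge (σ : ℤ) (c : ℝ) : ℝ := (1 + σ) / 2 - (1 - σ) / 2 * c

/-- The set `ℤ[l]`. -/
def quadInts (l : ℝ) : Set ℝ := Set.range fun p : ℤ × ℤ => (p.1 : ℝ) + p.2 * l

theorem countable_quadInts (l : ℝ) : (quadInts l).Countable := Set.countable_range _

theorem mem_quadInts (l : ℝ) (m n : ℤ) : (m : ℝ) + n * l ∈ quadInts l := ⟨(m, n), rfl⟩

namespace IsQuadraticUnit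

variable {r : ℕ} {σ : ℤ} {l c : ℝ} (h : IsQuadraticUnit r σ l c)
include h

theorem digit_le {ε : PrimarySet l} (hε : ε ∈ symbolicCompactum l r σ) (n : ℤ) : ε.1 n ≤ r := by
  rcases h.sigma_eq_or with hσ | hσ
  · exact (hε.1 hσ n).1
  · have := (hε.2 hσ).1 n; omega

theorem digit_cases_of_isLabelling {ε : ℤ → ℕ} {q : ℤ → Prop} (hq : IsLabelling r σ ε q) (n : ℤ) :
    (σ = -1 ∧ 1 ≤ (r : ℝ) ∧ ((¬ q n ∧ ¬ q (n + 1) ∧ (ε (n + 1) : ℝ) + 1 ≤ r) ∨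
      (¬ q n ∧ q (n + 1) ∧ (ε (n + 1) : ℝ) = r) ∨ (q n ∧ ¬ q (n + 1) ∧ (ε (n + 1) : ℝ) = 0))) ∨
    (σ = 1 ∧ 3 ≤ (r : ℝ) ∧ ((¬ q n ∧ ¬ q (n + 1) ∧ (ε (n + 1) : ℝ) + 2 ≤ r) ∨
      (¬ q n ∧ q (n + 1) ∧ (ε (n + 1) : ℝ) + 1 = r) ∨
      (q n ∧ ¬ q (n + 1) ∧ (ε (n + 1) : ℝ) + 3 ≤ r) ∨
      (q n ∧ q (n + 1) ∧ (ε (n + 1) : ℝ) + 2 = r))) := by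
  norm_cast
  rcases h.cases with ⟨hσ, hr⟩ | ⟨hσ, hr⟩
  · obtain ⟨-, -, hnext⟩ := hq.neg hσ n
    obtain ⟨hle, hiff, -⟩ := hq.neg hσ (n + 1)
    refine Or.inl ⟨hσ, hr, ?_⟩
    by_cases hn : q n <;> by_cases hn' : q (n + 1) <;> simp only [hn, hn'] at hnext hiff ⊢ <;>
      grind
  · have hfree := hq.pos_free hσ n
    have hbound := hq.pos_bound hσ n
    refine Or.inr ⟨hσ, hr, ?_⟩
    by_cases hn : q n <;> by_cases hn' : q (n + 1) <;>
      simp only [hn, hn'] at hfree hbound ⊢ <;> grind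

theorem add_futBound_le {ε : ℤ → ℕ} {q : ℤ → Prop} (hq : IsLabelling r σ ε q) (n : ℤ) :
    ε (n + 1) + futBound σ c (q (n + 1)) ≤ l * futBound σ c (q n) := by
  have hl := h.one_lt
  have hadd := h.add_eq
  have hmul := h.mul_eq
  rcases h.digit_cases_of_isLabelling hq n with ⟨rfl, _, H⟩ | ⟨rfl, _, H⟩ <;> push_cast at hmul
  · rcases H with ⟨hn, hn', hd⟩ | ⟨hn, hn', hd⟩ | ⟨hn, hn', hd⟩ <;>
      simp only [futBound, hn, hn', if_true, if_false] <;> push_cast <;> nlinarith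
  · rcases H with ⟨hn, hn', hd⟩ | ⟨hn, hn', hd⟩ | ⟨hn, hn', hd⟩ | ⟨hn, hn', hd⟩ <;>
      simp only [futBound, hn, hn', if_true, if_false] <;> push_cast <;> nlinarith

theorem futBound_mem_Ioc (q : Prop) : futBound σ c q ∈ Set.Ioc 0 1 := by
  obtain ⟨hc, hc'⟩ := abs_lt.1 h.abs_conj_lt_one
  have hmul := h.mul_eq
  have hl := h.pos
  rcases h.sigma_eq_or with rfl | rfl <;> unfold futBound <;> split_ifs <;> push_cast at * <;>
    constructor <;> nlinarith

theorem fut_le_futBound {ε : PrimarySet l} (hε : ε ∈ symbolicCompactum l r σ) {q : ℤ → Prop}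
    (hq : IsLabelling r σ ε.1 q) (n : ℤ) : fut l ε.1 n ≤ futBound σ c (q n) := by
  have hl := h.pos
  have hcontr := nonpos_of_contraction
    (e := fun k : ℕ => fut l ε.1 (n + k) - futBound σ c (q (n + k)))
    (q := l⁻¹) (M := fut l (fun _ => r) 0) (by positivity) (inv_lt_one_of_one_lt₀ h.one_lt)
    (fun k => ?_) fun k => ?_
  · simpa using hcontr
  · linarith [fut_le_of_bounded h.one_lt (h.digit_le hε) (n + k),
      (h.futBound_mem_Ioc (q (n + k))).1]
  · have hbound := h.add_futBound_le hq (n + k)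
    have hfut := fut_rec hl.ne' ε.2 (n + k)
    rw [le_inv_mul_iff₀ hl]
    push_cast
    rw [← add_assoc]
    linarith

theorem fut_le_one {ε : PrimarySet l} (hε : ε ∈ symbolicCompactum l r σ) (n : ℤ) :
    fut l ε.1 n ≤ 1 := by
  obtain ⟨q, hq⟩ := exists_labelling h.sigma_eq_or hε
  exact (h.fut_le_futBound hε hq n).trans (h.futBound_mem_Ioc _).2

theorem fut_lt_one {ε : PrimarySet l} (hε : ε ∈ symbolicCompactum l r σ)
    (hfin : (Function.support ε.1).Finite) (n : ℤ) : fut l ε.1 n < 1 := by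
  obtain ⟨q, hq⟩ := exists_labelling h.sigma_eq_or hε
  have hl := h.pos
  obtain ⟨N, hN⟩ := hfin.bddAbove
  have hzero {m : ℤ} (hm : N ≤ m) : fut l ε.1 m = 0 := by
    refine (tsum_congr fun k => ?_).trans tsum_zero
    have hdigit : ε.1 (m + (k + 1)) = 0 := by
      by_contra hne
      have hmem := hN (Function.mem_support.2 hne)
      omega
    simp [hdigit]
  have hstep (m : ℤ) (hm : fut l ε.1 (m + 1) < futBound σ c (q (m + 1))) :
      fut l ε.1 m < futBound σ c (q m) := by
    have hbound := h.add_futBound_le hq m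
    have hfut := fut_rec hl.ne' ε.2 m
    exact lt_of_mul_lt_mul_left (by linarith) hl.le
  refine lt_of_lt_of_le ?_ (h.futBound_mem_Ioc (q n)).2
  rcases le_total N n with hn | hn
  · exact (hzero hn).trans_lt (h.futBound_mem_Ioc _).1
  · induction n, hn using Int.leInductionDown with
    | base => exact (hzero le_rfl).trans_lt (h.futBound_mem_Ioc _).1
    | pred n _ ih => exact hstep _ (by simpa using ih)

theorem pastBound_step {ε : ℤ → ℕ} {q : ℤ → Prop} (hq : IsLabelling r σ ε q) (n : ℤ) {y e : ℝ}
    (hlower : pastLower σ l (q n) - y ≤ e) (hupper : y - pastUpper l (q n) ≤ e) :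
    pastLower σ l (q (n + 1)) - (ε (n + 1) + c * y) ≤ l⁻¹ * e ∧
      ε (n + 1) + c * y - pastUpper l (q (n + 1)) ≤ l⁻¹ * e := by
  have hl := h.one_lt
  have hsq := h.sq_eq
  have hd0 : (0 : ℝ) ≤ ε (n + 1) := by positivity
  rw [le_inv_mul_iff₀ h.pos, le_inv_mul_iff₀ h.pos, mul_sub, mul_sub,
    show l * (ε (n + 1) + c * y) = l * ε (n + 1) + σ * y by rw [← h.mul_eq]; ring]
  rcases h.digit_cases_of_isLabelling hq n with ⟨rfl, _, H⟩ | ⟨rfl, _, H⟩ <;> push_cast at hsq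
  · rcases H with ⟨hn, hn', hd⟩ | ⟨hn, hn', hd⟩ | ⟨hn, hn', hd⟩ <;>
      simp only [pastLower, pastUpper, hn, hn', if_true, if_false] at hlower hupper ⊢ <;>
      push_cast at hlower hupper ⊢ <;> constructor <;> nlinarith [hd0]
  · rcases H with ⟨hn, hn', hd⟩ | ⟨hn, hn', hd⟩ | ⟨hn, hn', hd⟩ | ⟨hn, hn', hd⟩ <;>
      simp only [pastLower, pastUpper, hn, hn', if_true, if_false] at hlower hupper ⊢ <;>
      push_cast at hlower hupper ⊢ <;> constructor <;> nlinarith [hd0]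

theorem abs_past_le {ε : ℤ → ℕ} {b : ℕ} (hε : ∀ n, ε n ≤ b) (n : ℤ) :
    |past c ε n| ≤ b * (1 - |c|)⁻¹ := by
  have hs := (hasSum_geometric_of_lt_one (abs_nonneg c) h.abs_conj_lt_one).mul_left (b : ℝ)
  rw [← Real.norm_eq_abs (past c ε n)]
  refine tsum_of_norm_bounded hs fun k => ?_
  rw [norm_mul, norm_pow, Real.norm_natCast, Real.norm_eq_abs]
  gcongr
  exact hε _

theorem past_mem_Icc {ε : PrimarySet l} (hε : ε ∈ symbolicCompactum l r σ) {q : ℤ → Prop}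
    (hq : IsLabelling r σ ε.1 q) (n : ℤ) :
    past c ε.1 n ∈ Set.Icc (pastLower σ l (q n)) (pastUpper l (q n)) := by
  have hl := h.pos
  let excess : ℤ → ℝ := fun n =>
    max (pastLower σ l (q n) - past c ε.1 n) (past c ε.1 n - pastUpper l (q n))
  have hexcess : excess n ≤ 0 := by
    have hcontr := nonpos_of_contraction (e := fun k : ℕ => excess (n - k)) (q := l⁻¹)
      (M := r * (1 - |c|)⁻¹ + l + 1) (by positivity) (inv_lt_one_of_one_lt₀ h.one_lt)
      (fun k => ?_) fun k => ?_
    · simpa using hcontr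
    · obtain ⟨hge, hle⟩ := abs_le.1 (h.abs_past_le (h.digit_le hε) (n - k))
      have hlower : pastLower σ l (q (n - k)) ≤ l + 1 := by
        unfold pastLower
        rcases h.sigma_eq_or with hσ | hσ <;> rw [hσ] <;> split_ifs <;> push_cast <;> linarith
      have hupper : 0 ≤ pastUpper l (q (n - k)) := by
        unfold pastUpper
        split_ifs <;> linarith [h.one_lt]
      refine max_le ?_ ?_ <;> linarith
    · have hstep := h.pastBound_step hq (n - (k + 1 : ℕ))
        (y := past c ε.1 (n - (k + 1 : ℕ))) (le_max_left _ _) (le_max_right _ _)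
      rw [← h.past_rec ε.2, show n - ((k + 1 : ℕ) : ℤ) + 1 = n - k by push_cast; ring] at hstep
      exact max_le hstep.1 hstep.2
  exact ⟨by linarith [(le_max_left _ _).trans hexcess],
    by linarith [(le_max_right _ _).trans hexcess]⟩

theorem mem_quadInts_of_mul {x : ℝ} (hx : l * x ∈ quadInts l) : x ∈ quadInts l := by
  obtain ⟨⟨m, n⟩, hmn⟩ := hx
  refine ⟨(n + m * σ * r, -m * σ), ?_⟩
  refine mul_left_cancel₀ h.pos.ne' ?_
  rw [← hmn]
  push_cast
  linear_combination (-m * σ) * h.sq_eq + m * h.sigma_sq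

theorem digit_and_fut_succ_eq {ε ε' : PrimarySet l} {n : ℤ} (heq : fut l ε.1 n = fut l ε'.1 n)
    (hlt : fut l ε.1 (n + 1) < 1) (hlt' : fut l ε'.1 (n + 1) < 1) :
    ε.1 (n + 1) = ε'.1 (n + 1) ∧ fut l ε.1 (n + 1) = fut l ε'.1 (n + 1) := by
  have hrec := fut_rec h.pos.ne' ε.2 n
  have hrec' := fut_rec h.pos.ne' ε'.2 n
  have hnonneg := fut_nonneg h.pos ε.1 (n + 1)
  have hnonneg' := fut_nonneg h.pos ε'.1 (n + 1)
  rw [heq] at hrec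
  have hdigit : ε.1 (n + 1) = ε'.1 (n + 1) := by
    have hle : (ε.1 (n + 1) : ℝ) < ε'.1 (n + 1) + 1 := by linarith
    have hge : (ε'.1 (n + 1) : ℝ) < ε.1 (n + 1) + 1 := by linarith
    norm_cast at hle hge
    omega
  refine ⟨hdigit, ?_⟩
  rw [hrec', hdigit] at hrec
  linarith

theorem fut_add_notMem_quadInts {ε : PrimarySet l} {n : ℤ} (hx : fut l ε.1 n ∉ quadInts l) (k : ℕ) :
    fut l ε.1 (n + k) ∉ quadInts l := by
  induction k with
  | zero => simpa using hx
  | succ k ih =>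
    rintro ⟨⟨a, b⟩, hab⟩
    refine ih (h.mem_quadInts_of_mul ⟨(a + ε.1 (n + k + 1), b), ?_⟩)
    push_cast [← add_assoc] at hab ⊢
    rw [fut_rec h.pos.ne' ε.2, ← hab]
    ring

theorem fut_lt_one_of_notMem_quadInts {ε : PrimarySet l} (hε : ε ∈ symbolicCompactum l r σ)
    {n : ℤ} (hx : fut l ε.1 n ∉ quadInts l) : fut l ε.1 n < 1 :=
  (h.fut_le_one hε n).lt_of_ne fun h1 => hx ⟨(1, 0), by simp [h1]⟩

theorem digits_eq_of_fut_eq {ε ε' : PrimarySet l} {n : ℤ} (heq : fut l ε.1 n = fut l ε'.1 n)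
    (hlt : ∀ k : ℕ, fut l ε.1 (n + k) < 1) (hlt' : ∀ k : ℕ, fut l ε'.1 (n + k) < 1) (k : ℕ) :
    ε.1 (n + k + 1) = ε'.1 (n + k + 1) := by
  have heq_add (k : ℕ) : fut l ε.1 (n + k) = fut l ε'.1 (n + k) := by
    induction k with
    | zero => simpa using heq
    | succ k ih =>
      have hsucc := hlt (k + 1)
      have hsucc' := hlt' (k + 1)
      push_cast [← add_assoc] at hsucc hsucc' ⊢
      exact (h.digit_and_fut_succ_eq ih hsucc hsucc').2
  have hsucc := hlt (k + 1)
  have hsucc' := hlt' (k + 1)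
  push_cast [← add_assoc] at hsucc hsucc'
  exact (h.digit_and_fut_succ_eq (heq_add k) hsucc hsucc').1

theorem past_mem_Icc_pastEdge {ε : PrimarySet l} (hε : ε ∈ symbolicCompactum l r σ) (n : ℤ) :
    past c ε.1 n ≤ ε.1 n + pastEdge σ c ∧
      (1 ≤ ε.1 n → ε.1 n - 1 + pastEdge σ c ≤ past c ε.1 n) := by
  obtain ⟨q, hq⟩ := exists_labelling h.sigma_eq_or hε
  obtain ⟨hlower, hupper⟩ := h.past_mem_Icc hε hq (n - 1)
  have hrec := h.past_rec ε.2 (n - 1)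
  rw [sub_add_cancel] at hrec
  have hl := h.one_lt
  have hmul := h.mul_eq
  rw [hrec, pastEdge]
  rcases h.sigma_eq_or with hσ | hσ
  · have hlab := hq.neg hσ (n - 1)
    rw [sub_add_cancel] at hlab
    rw [hσ] at hmul hlower ⊢
    push_cast at hmul ⊢
    have hge : -1 ≤ past c ε.1 (n - 1) := by
      refine le_trans ?_ hlower
      unfold pastLower
      split_ifs <;> push_cast <;> linarith
    refine ⟨by nlinarith, fun hd => ?_⟩
    have hnq : ¬ q (n - 1) := fun hqn => by have := hlab.2.2 hqn; omega
    simp only [pastUpper, hnq, if_false] at hupper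
    nlinarith
  · rw [hσ] at hmul hlower ⊢
    push_cast at hmul ⊢
    have hge : 0 ≤ past c ε.1 (n - 1) := by
      refine le_trans ?_ hlower
      unfold pastLower
      split_ifs <;> push_cast <;> linarith
    have hle : past c ε.1 (n - 1) ≤ l := by
      refine hupper.trans ?_
      unfold pastUpper
      split_ifs <;> linarith
    exact ⟨by nlinarith, fun _ => by nlinarith⟩

theorem add_pastEdge_mem_quadInts (d : ℕ) : (d : ℝ) + pastEdge σ c ∈ quadInts c := by
  unfold pastEdge
  rcases h.sigma_eq_or with rfl | rfl
  · exact ⟨(d, -1), by push_cast; ring⟩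
  · exact ⟨(d + 1, 0), by push_cast; ring⟩

theorem digit_le_of_past_eq {ε ε' : PrimarySet l} (hε : ε ∈ symbolicCompactum l r σ)
    (hε' : ε' ∈ symbolicCompactum l r σ) {n : ℤ} (heq : past c ε.1 n = past c ε'.1 n)
    (hx : past c ε.1 n ∉ quadInts c) : ε'.1 n ≤ ε.1 n := by
  by_contra! hlt
  have hle := (h.past_mem_Icc_pastEdge hε n).1
  have hge := (h.past_mem_Icc_pastEdge hε' n).2 (by omega)
  have hdigit : (ε.1 n : ℝ) + 1 ≤ ε'.1 n := by exact_mod_cast hlt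
  refine hx ?_
  rw [show past c ε.1 n = ε.1 n + pastEdge σ c by linarith]
  exact h.add_pastEdge_mem_quadInts _

theorem past_pred_notMem_quadInts {ε : PrimarySet l} {n : ℤ} (hx : past c ε.1 n ∉ quadInts c) :
    past c ε.1 (n - 1) ∉ quadInts c := by
  rintro ⟨⟨a, b⟩, hab⟩
  have hrec := h.past_rec ε.2 (n - 1)
  rw [sub_add_cancel] at hrec
  refine hx ⟨(ε.1 n - b * σ, a + b * r), ?_⟩
  rw [hrec, ← hab]
  push_cast
  linear_combination (-b) * h.conj_sq_eq

theorem digits_eq_of_past_eq {ε ε' : PrimarySet l} (hε : ε ∈ symbolicCompactum l r σ)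
    (hε' : ε' ∈ symbolicCompactum l r σ) {n : ℤ} (heq : past c ε.1 n = past c ε'.1 n)
    (hx : past c ε.1 n ∉ quadInts c) (k : ℕ) : ε.1 (n - k) = ε'.1 (n - k) := by
  have hdigit {n : ℤ} (heq : past c ε.1 n = past c ε'.1 n) (hx : past c ε.1 n ∉ quadInts c) :
      ε.1 n = ε'.1 n :=
    le_antisymm (h.digit_le_of_past_eq hε' hε heq.symm (heq ▸ hx))
      (h.digit_le_of_past_eq hε hε' heq hx)
  induction k generalizing n with
  | zero => simpa using hdigit heq hx
  | succ k ih =>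
    have hrec := h.past_rec ε.2 (n - 1)
    have hrec' := h.past_rec ε'.2 (n - 1)
    rw [sub_add_cancel] at hrec hrec'
    have heq' : past c ε.1 (n - 1) = past c ε'.1 (n - 1) := by
      refine mul_left_cancel₀ h.conj_ne_zero ?_
      rw [heq, hrec', hdigit heq hx] at hrec
      linarith
    convert ih heq' (h.past_pred_notMem_quadInts hx) using 2 <;> push_cast <;> ring

theorem eq_of_fut_eq_of_past_eq {ε ε' : PrimarySet l} (hε : ε ∈ symbolicCompactum l r σ)
    (hε' : ε' ∈ symbolicCompactum l r σ) (hfut : fut l ε.1 0 = fut l ε'.1 0)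
    (hpast : past c ε.1 0 = past c ε'.1 0) (hx : fut l ε.1 0 ∉ quadInts l)
    (hy : past c ε.1 0 ∉ quadInts c) : ε = ε' := by
  ext n
  rcases lt_or_ge 0 n with hn | hn
  · have hdigit := h.digits_eq_of_fut_eq hfut
      (fun k => h.fut_lt_one_of_notMem_quadInts hε (h.fut_add_notMem_quadInts hx k))
      (fun k => h.fut_lt_one_of_notMem_quadInts hε' (h.fut_add_notMem_quadInts (hfut ▸ hx) k))
      (n - 1).toNat
    rwa [show (0 : ℤ) + (n - 1).toNat + 1 = n by omega] at hdigit
  · have hdigit := h.digits_eq_of_past_eq hε hε' hpast hy (-n).toNat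
    rwa [show (0 : ℤ) - (-n).toNat = n by omega] at hdigit

end IsQuadraticUnit

/-! ### Greedy expansions and surjectivity -/

theorem past_eq_zero (c : ℝ) {ε : ℤ → ℕ} {n : ℤ} (hε : ∀ k ≤ n, ε k = 0) : past c ε n = 0 := by
  refine (tsum_congr fun k => ?_).trans tsum_zero
  simp [hε (n - k) (by omega)]

theorem fut_eq_of_expansion {l : ℝ} (hl : 1 < l) {ε : ℤ → ℕ} (hε : ε ∈ PrimarySet l) {b : ℕ}
    (hb : ∀ n, ε n ≤ b) {y : ℤ → ℝ} (hy : ∀ n, y n ∈ Set.Ico 0 1)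
    (hrec : ∀ n, l * y n = ε (n + 1) + y (n + 1)) (n : ℤ) : fut l ε n = y n := by
  have hl0 : 0 < l := by linarith
  have hq0 : 0 ≤ l⁻¹ := by positivity
  have hdiff (k : ℤ) : fut l ε k - y k = l⁻¹ * (fut l ε (k + 1) - y (k + 1)) := by
    rw [eq_inv_mul_iff_mul_eq₀ hl0.ne']
    linarith [fut_rec hl0.ne' hε k, hrec k]
  have hle := nonpos_of_contraction (e := fun k : ℕ => fut l ε (n + k) - y (n + k))
    (M := fut l (fun _ => b) 0) hq0 (inv_lt_one_of_one_lt₀ hl)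
    (fun k => by linarith [fut_le_of_bounded hl hb (n + k), (hy (n + k)).1])
    fun k => by push_cast [← add_assoc]; exact (hdiff _).le
  have hge := nonpos_of_contraction (e := fun k : ℕ => y (n + k) - fut l ε (n + k)) (M := 1) hq0
    (inv_lt_one_of_one_lt₀ hl)
    (fun k => by linarith [fut_nonneg hl0 ε (n + k), (hy (n + k)).2])
    fun k => by push_cast [← add_assoc]; linarith [hdiff (n + k)]
  simp only [Nat.cast_zero, add_zero] at hle hge
  linarith

theorem exists_greedy_expansion {l x : ℝ} (hl : 1 < l) (hx : x ∈ Set.Ico 0 1) :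
    ∃ (ε : ℤ → ℕ) (y : ℤ → ℝ), y 0 = x ∧ (∀ n ≤ 0, ε n = 0) ∧ (∀ n, y n ∈ Set.Ico 0 1) ∧
      ∀ n, l * y n = ε (n + 1) + y (n + 1) := by
  have hl0 : 0 < l := by linarith
  let y : ℤ → ℝ := fun n => if n ≤ 0 then x * l ^ n else (fun z => Int.fract (l * z))^[n.toNat] x
  have hy_neg {n : ℤ} (hn : n ≤ 0) : y n = x * l ^ n := if_pos hn
  have hy_nat (k : ℕ) : y k = (fun z => Int.fract (l * z))^[k] x := by
    rcases k.eq_zero_or_pos with rfl | hk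
    · simp [y]
    · simp [y, hk.ne']
  have hy (n : ℤ) : y n ∈ Set.Ico 0 1 := by
    rcases le_or_gt n 0 with hn | hn
    · rw [hy_neg hn]
      exact ⟨mul_nonneg hx.1 (by positivity),
        mul_lt_one_of_nonneg_of_lt_one_left hx.1 hx.2 (zpow_le_one_of_nonpos₀ hl.le hn)⟩
    · obtain ⟨k, rfl⟩ : ∃ k : ℕ, n = (k + 1 : ℕ) := ⟨(n - 1).toNat, by omega⟩
      rw [hy_nat, Function.iterate_succ_apply']
      exact ⟨Int.fract_nonneg _, Int.fract_lt_one _⟩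
  have hmul {n : ℤ} (hn : n < 0) : l * y n = y (n + 1) := by
    rw [hy_neg hn.le, hy_neg (by omega), zpow_add_one₀ hl0.ne']; ring
  have hfract (n : ℤ) : y (n + 1) = Int.fract (l * y n) := by
    rcases lt_or_ge n 0 with hn | hn
    · rw [hmul hn, Int.fract_eq_self.2 (hy _)]
    · lift n to ℕ using hn
      rw [hy_nat, ← Nat.cast_add_one, hy_nat, Function.iterate_succ_apply']
  refine ⟨fun n => ⌊l * y (n - 1)⌋₊, y, by simp [y], fun n hn => ?_, hy, fun n => ?_⟩
  · beta_reduce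
    rw [hmul (by omega), Nat.floor_eq_zero]
    exact (hy _).2
  · beta_reduce
    rw [hfract, add_sub_cancel_right,
      natCast_floor_eq_intCast_floor (mul_nonneg hl0.le (hy n).1), Int.floor_add_fract]

namespace IsQuadraticUnit

variable {r : ℕ} {σ : ℤ} {l c : ℝ} (h : IsQuadraticUnit r σ l c)
include h

theorem toralMap_eigenMk_fut_past (m n : ℤ) (ε : PrimarySet l) (k : ℤ) :
    toralMap (companionMatrix r σ)
      (eigenMk l c ((m + n * l) * fut l ε.1 k, -((m + n * c) * past c ε.1 k))) =
    eigenMk l c ((m + n * l) * fut l ε.1 (k + 1), -((m + n * c) * past c ε.1 (k + 1))) := by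
  have hshift := h.coding_shift m n ⟨_, translate_mem ε.2 k⟩
  have hfut (j : ℤ) : fut l (fun i => ε.1 (i + k)) j = fut l ε.1 (k + j) :=
    tsum_congr fun i => by ring_nf
  have hpast (j : ℤ) : past c (fun i => ε.1 (i + k)) j = past c ε.1 (k + j) :=
    tsum_congr fun i => by ring_nf
  unfold coding at hshift
  simpa [fut_shift, past_shift, hfut, hpast] using hshift.symm

theorem eigenMk_fut_past_eq_of_coding_eq {m n : ℤ} {ε ε' : PrimarySet l}
    (heq : coding l c m n ε = coding l c m n ε') (N : ℕ) :
    eigenMk l c ((m + n * l) * fut l ε.1 (-N), -((m + n * c) * past c ε.1 (-N))) =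
      eigenMk l c ((m + n * l) * fut l ε'.1 (-N), -((m + n * c) * past c ε'.1 (-N))) := by
  induction N with
  | zero => simpa [coding] using heq
  | succ N ih =>
    apply h.toralMap_companionMatrix_injective
    simp only [h.toralMap_eigenMk_fut_past]
    rwa [show -((N + 1 : ℕ) : ℤ) + 1 = -N by push_cast; ring]

theorem eigenMk_unstable_injective : Function.Injective fun x : ℝ => eigenMk l c (x, 0) := by
  intro x y hxy
  obtain ⟨u, v, huv⟩ := (h.eigenMk_eq_iff _ _).1 hxy
  obtain ⟨hfst, hsnd⟩ := Prod.mk.inj huv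
  obtain ⟨rfl, rfl⟩ : u = 0 ∧ v = 0 := by
    by_contra hne
    refine h.conj_linear_ne_zero (m := u) (n := v) (by simpa using hne) ?_
    simpa using hsnd.symm
  simpa using hfst

theorem coding_injOn_finite {m n : ℤ} (hmn : (m, n) ≠ (0, 0)) :
    Set.InjOn (coding l c m n)
      {ε | ε ∈ symbolicCompactum l r σ ∧ (Function.support ε.1).Finite} := by
  rintro ε ⟨hε, hfin⟩ ε' ⟨hε', hfin'⟩ heq
  obtain ⟨a, ha⟩ := (hfin.union hfin').bddBelow
  obtain ⟨N, hN⟩ : ∃ N : ℕ, -(N : ℤ) < a := ⟨(1 - a).toNat, by omega⟩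
  have hzero (k : ℤ) (hk : k ≤ -N) : ε.1 k = 0 ∧ ε'.1 k = 0 := by
    by_contra hne
    have hmem := ha (show k ∈ Function.support ε.1 ∪ Function.support ε'.1 by
      simpa [imp_iff_not_or, not_and_or] using hne)
    omega
  have hfut : fut l ε.1 (-N) = fut l ε'.1 (-N) := by
    have hback := h.eigenMk_fut_past_eq_of_coding_eq heq N
    rw [past_eq_zero c fun k hk => (hzero k hk).1, past_eq_zero c fun k hk => (hzero k hk).2,
      mul_zero, neg_zero] at hback
    exact mul_left_cancel₀ (h.linear_ne_zero hmn) (h.eigenMk_unstable_injective hback)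
  ext k
  rcases le_or_gt k (-N) with hk | hk
  · rw [(hzero k hk).1, (hzero k hk).2]
  · have hdigit := h.digits_eq_of_fut_eq hfut (fun _ => h.fut_lt_one hε hfin _)
      (fun _ => h.fut_lt_one hε' hfin' _) (k + N - 1).toNat
    rwa [show -(N : ℤ) + (k + N - 1).toNat + 1 = k by omega] at hdigit

theorem digit_le_of_expansion {ε : ℤ → ℕ} {y : ℤ → ℝ} (hy : ∀ n, y n ∈ Set.Ico 0 1)
    (hrec : ∀ n, l * y n = ε (n + 1) + y (n + 1)) (n : ℤ) :
    ε n ≤ r ∧ (σ = 1 → ε n + 1 ≤ r) := by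
  have hl := h.pos
  have hlt : (ε n : ℝ) < l := by
    have hprev := hrec (n - 1)
    rw [sub_add_cancel] at hprev
    nlinarith [(hy n).1, (hy (n - 1)).2]
  have hadd := h.add_eq
  constructor
  · have hlt_succ : (ε n : ℝ) < r + 1 := by linarith [(abs_lt.1 h.abs_conj_lt_one).1]
    norm_cast at hlt_succ
    omega
  · intro hσ
    have hmul := h.mul_eq
    rw [hσ] at hmul
    push_cast at hmul
    have hlt_r : (ε n : ℝ) < r := by nlinarith
    exact_mod_cast hlt_r

theorem mem_symbolicCompactum_of_expansion {ε : PrimarySet l} {y : ℤ → ℝ}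
    (hy : ∀ n, y n ∈ Set.Ico 0 1) (hrec : ∀ n, l * y n = ε.1 (n + 1) + y (n + 1)) :
    ε ∈ symbolicCompactum l r σ := by
  have hl := h.pos
  have hadd := h.add_eq
  have hmul := h.mul_eq
  have hprev (n : ℤ) : l * y (n - 1) = ε.1 n + y n := by simpa using hrec (n - 1)
  refine ⟨fun hσ n => ⟨(h.digit_le_of_expansion hy hrec n).1, fun hn => ?_⟩,
    fun hσ => ⟨fun n => (h.digit_le_of_expansion hy hrec n).2 hσ, ?_⟩⟩
  · rw [hσ] at hmul
    push_cast at hmul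
    have hy_lt : y n < -c := by
      have hrec_n := hprev n
      rw [hn] at hrec_n
      nlinarith [(hy (n - 1)).2]
    have hlt_one : (ε.1 (n + 1) : ℝ) < 1 := by nlinarith [hrec n, (hy (n + 1)).1]
    norm_cast at hlt_one
    omega
  · rw [hσ] at hmul
    push_cast at hmul
    rintro n j ⟨hfirst, hmiddle, hlast⟩
    have hy_lt (i : ℕ) (hi : i ≤ j) : y (n + i) < 1 - c := by
      induction i with
      | zero =>
        have hdigit : (ε.1 n : ℝ) + 1 = r := by exact_mod_cast hfirst
        simp only [Nat.cast_zero, add_zero]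
        nlinarith [hprev n, (hy (n - 1)).2]
      | succ i ih =>
        have hdigit : (ε.1 (n + i + 1) : ℝ) + 2 = r := by
          rw [add_assoc]; exact_mod_cast hmiddle (i + 1) (by omega) hi
        push_cast [← add_assoc]
        nlinarith [hrec (n + i), ih (by omega)]
    have hdigit : (ε.1 (n + j + 1) : ℝ) + 1 = r := by exact_mod_cast hlast
    have hc : 0 < c := pos_of_mul_pos_right (hmul ▸ one_pos) hl.le
    have hmul_lt := mul_lt_mul_of_pos_left (hy_lt j le_rfl) hl
    linarith [hrec (n + j), (hy (n + j + 1)).1]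

theorem exists_fut_eq_and_past_eq_zero {x : ℝ} (hx : x ∈ Set.Ico 0 1) :
    ∃ ε ∈ symbolicCompactum l r σ, fut l ε.1 0 = x ∧ past c ε.1 0 = 0 := by
  obtain ⟨ε, y, rfl, hzero, hy, hrec⟩ := exists_greedy_expansion h.one_lt hx
  have hle (n : ℤ) := (h.digit_le_of_expansion hy hrec n).1
  have hε := mem_of_bounded h.one_lt hle
  exact ⟨⟨ε, hε⟩, h.mem_symbolicCompactum_of_expansion hy hrec,
    fut_eq_of_expansion h.one_lt hε hle hy hrec 0, past_eq_zero c hzero⟩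

theorem isCompact_of_isClosed_subset {Y : Set (PrimarySet l)} (hY : IsClosed Y)
    (hsub : Y ⊆ symbolicCompactum l r σ) : IsCompact Y :=
  (isCompact_le_const h.one_lt r).of_isClosed_subset hY fun _ hε => h.digit_le (hsub hε)

theorem isCompact_image_coding (m n : ℤ) {Y : Set (PrimarySet l)} (hY : IsClosed Y)
    (hsub : Y ⊆ symbolicCompactum l r σ) : IsCompact (coding l c m n '' Y) :=
  (h.isCompact_of_isClosed_subset hY hsub).image_of_continuousOn
    ((h.continuousOn_coding m n (constSeq h.one_lt r)).mono fun _ hε => h.digit_le (hsub hε))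

theorem coding_iterate_shift (m n : ℤ) (ε : PrimarySet l) (k : ℕ) :
    coding l c m n (shift^[k] ε) =
      (toralMap (companionMatrix r σ))^[k] (coding l c m n ε) :=
  (Function.Semiconj.iterate_right (fun ε => h.coding_shift m n ε) k) ε

theorem unstable_halfLine_subset_image_coding :
    (fun x : ℝ => eigenMk l c (x, 0)) '' Set.Ici 0 ⊆
      coding l c 1 0 '' symbolicCompactum l r σ := by
  have hl := h.pos
  rintro _ ⟨x, hx : 0 ≤ x, rfl⟩
  obtain ⟨k, hk⟩ := pow_unbounded_of_one_lt x h.one_lt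
  obtain ⟨ε, hε, hfut, hpast⟩ := h.exists_fut_eq_and_past_eq_zero (x := x / l ^ k)
    ⟨by positivity, (div_lt_one (by positivity)).2 hk⟩
  have hmaps : Set.MapsTo shift (symbolicCompactum l r σ) (symbolicCompactum l r σ) :=
    fun ε hε => (shift_mem_symbolicCompactum ε).2 hε
  refine ⟨shift^[k] ε, hmaps.iterate k hε, ?_⟩
  rw [h.coding_iterate_shift, coding, hfut, hpast, h.iterate_toralMap_companionMatrix]
  simp [mul_div_cancel₀ x (pow_ne_zero k hl.ne')]

theorem image_coding_symbolicCompactum {m n : ℤ} (hmn : (m, n) ≠ (0, 0)) :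
    coding l c m n '' symbolicCompactum l r σ = Set.univ := by
  have hclosed : IsClosed (coding l c 1 0 '' symbolicCompactum l r σ) :=
    (h.isCompact_image_coding 1 0 (isClosed_symbolicCompactum l r σ) subset_rfl).isClosed
  have huniv : coding l c 1 0 '' symbolicCompactum l r σ = Set.univ :=
    hclosed.closure_eq ▸
      (h.dense_unstable_halfLine.mono h.unstable_halfLine_subset_image_coding).closure_eq
  refine Set.eq_univ_of_forall fun t => ?_
  obtain ⟨s, rfl⟩ := toralMap_surjective (h.det_mulMatrix_ne_zero hmn) t
  obtain ⟨ε, hε, rfl⟩ := huniv.symm ▸ Set.mem_univ s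
  exact ⟨ε, hε, h.coding_eq_toralMap m n ε⟩

end IsQuadraticUnit

theorem IsQuadraticUnit.isArithmeticCoding {r : ℕ} {σ : ℤ} {c : ℝ}
    (h : IsQuadraticUnit r σ (eigenLam (companionMatrix r σ)) c) {m n : ℤ} (hmn : (m, n) ≠ (0, 0)) :
    IsArithmeticCoding (companionMatrix r σ) (coding _ c m n) (symbolicCompactum _ r σ) :=
  ⟨h.coding_add m n, h.continuousOn_coding m n, h.coding_shift m n,
    isClosed_symbolicCompactum _ r σ, shift_mem_symbolicCompactum,
    isTotalSet_symbolicCompactum _ r σ, h.image_coding_symbolicCompactum hmn,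
    h.coding_injOn_finite hmn⟩

/-! ### Almost everywhere uniqueness -/

theorem setLIntegral_tsum_indicator_vadd {G α : Type*} [AddGroup G] [Countable G] [AddAction G α]
    [MeasurableSpace α] [MeasurableConstVAdd G α] {μ : Measure α} [VAddInvariantMeasure G α μ]
    {F S : Set α} (hF : IsAddFundamentalDomain G F μ) (hS : MeasurableSet S) :
    ∫⁻ x in F, ∑' g : G, S.indicator 1 (g +ᵥ x) ∂μ = μ S := by
  have hmeas (g : G) : Measurable fun x => S.indicator (1 : α → ENNReal) (g +ᵥ x) :=
    (measurable_one.indicator hS).comp (measurable_const_vadd g)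
  rw [lintegral_tsum fun g => (hmeas g).aemeasurable, hF.measure_eq_tsum, ← (Equiv.neg G).tsum_eq]
  refine tsum_congr fun g => ?_
  have hpre : MeasurableSet ((-g +ᵥ ·) ⁻¹' S : Set α) := measurable_const_vadd (-g) hS
  change ∫⁻ x in F, ((-g +ᵥ ·) ⁻¹' S : Set α).indicator 1 x ∂μ = _
  rw [lintegral_indicator_one hpre, Measure.restrict_apply hpre, Set.preimage_vadd, neg_neg]

open scoped Pointwise in
theorem ae_existsUnique_vadd_mem {G α : Type*} [AddGroup G] [Countable G] [AddAction G α]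
    [MeasurableSpace α] [MeasurableConstVAdd G α] {μ : Measure α} [VAddInvariantMeasure G α μ]
    {F S : Set α} (hF : IsAddFundamentalDomain G F μ) (hS : MeasurableSet S) (hle : μ S ≤ μ F)
    (htop : μ F ≠ ⊤) (hcov : ∀ x, ∃ g : G, g +ᵥ x ∈ S) :
    ∀ᵐ x ∂μ, ∃! g : G, g +ᵥ x ∈ S := by
  let mult (x : α) : ENNReal := ∑' g : G, S.indicator 1 (g +ᵥ x)
  have hmeas (g : G) : Measurable fun x => S.indicator (1 : α → ENNReal) (g +ᵥ x) :=
    (measurable_one.indicator hS).comp (measurable_const_vadd g)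
  have one_le_mult (x : α) : 1 ≤ mult x := by
    obtain ⟨g, hg⟩ := hcov x
    refine le_trans ?_ (ENNReal.le_tsum g)
    rw [Set.indicator_of_mem hg, Pi.one_apply]
  have mult_eq_one : ∀ᵐ x ∂μ.restrict F, (1 : ENNReal) = mult x := by
    refine ae_eq_of_ae_le_of_lintegral_le (.of_forall one_le_mult) ?_
      (Measurable.tsum hmeas).aemeasurable ?_
    · simpa using htop
    · simpa [mult, setLIntegral_tsum_indicator_vadd hF hS] using hle
  have unique_of_mult {x : α} (hx : 1 = mult x) : ∃! g : G, g +ᵥ x ∈ S := by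
    obtain ⟨g, hg⟩ := hcov x
    refine ⟨g, hg, fun g' hg' => ?_⟩
    classical
    by_contra hne
    have hpair := ENNReal.sum_le_tsum (f := fun g => S.indicator (1 : α → ENNReal) (g +ᵥ x))
      ({g', g} : Finset G)
    rw [Finset.sum_pair hne, Set.indicator_of_mem hg, Set.indicator_of_mem hg'] at hpair
    exact absurd (hpair.trans hx.ge) (by norm_num)
  have invariant (g : G) :
      g +ᵥ {x : α | ¬∃! g : G, g +ᵥ x ∈ S} = {x | ¬∃! g : G, g +ᵥ x ∈ S} := by
    ext x
    rw [Set.mem_vadd_set_iff_neg_vadd_mem, Set.mem_ofPred_eq, Set.mem_ofPred_eq, not_iff_not]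
    simp only [vadd_vadd]
    exact (Equiv.addRight (-g)).existsUnique_congr_right (q := fun g => g +ᵥ x ∈ S)
  refine hF.measure_zero_of_invariant _ invariant ?_
  rw [← Measure.restrict_apply₀' hF.nullMeasurableSet]
  exact mult_eq_one.mono fun x hx => unique_of_mult hx

theorem ae_notMem_countable (i : Fin 2) {s : Set ℝ} (hs : s.Countable) :
    ∀ᵐ w : Fin 2 → ℝ, w i ∉ s :=
  (Measure.quasiMeasurePreserving_eval (fun _ : Fin 2 => (volume : Measure ℝ)) i).ae
    (measure_eq_zero_iff_ae_notMem.1 (hs.measure_zero volume))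

theorem ae_mulVec {M : Matrix (Fin 2) (Fin 2) ℝ} (hM : M.det ≠ 0) {Q : (Fin 2 → ℝ) → Prop}
    (hQ : ∀ᵐ w, Q w) : ∀ᵐ w, Q (M.mulVec w) := by
  simpa using (Measure.LinearMap.quasiMeasurePreserving (volume : Measure (Fin 2 → ℝ))
    (Matrix.toLin' M) (by rwa [LinearMap.det_toLin'])).ae hQ

theorem ae_torus_of_ae_torusMk {Q : Torus2 → Prop} (hQ : ∀ᵐ z, Q (torusMk z)) :
    ∀ᵐ t : Torus2, Q t := by
  have hcircle : MeasurePreserving (fun t : UnitAddCircle => ((AddCircle.equivIoc 1 0 t : _) : ℝ))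
      volume (volume.restrict (Set.Ioc (0 : ℝ) (0 + 1))) :=
    (measurePreserving_subtype_coe measurableSet_Ioc).comp
      (AddCircle.measurePreserving_equivIoc (T := (1 : ℝ)) (a := 0))
  have htorus := measurePreserving_pi (ι := Fin 2) _ _ fun _ => hcircle
  rw [← Measure.restrict_pi_pi] at htorus
  refine (htorus.quasiMeasurePreserving.ae (ae_restrict_of_ae hQ)).mono fun t ht => ?_
  convert ht using 1
  ext i
  exact ((AddCircle.equivIoc 1 0).symm_apply_apply (t i)).symm

theorem toralMap_eq_torusMk_iff {M : Matrix (Fin 2) (Fin 2) ℤ} (hM : M.det ≠ 0) (y : Torus2)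
    (z : Fin 2 → ℝ) : toralMap M y = torusMk z ↔
      ∃ k : Fin 2 → ℤ, y = torusMk ((M.map Int.cast)⁻¹.mulVec (z + fun i => (k i : ℝ))) := by
  have hunit := isUnit_det_map_intCast hM
  constructor
  · intro hy
    obtain ⟨x, rfl⟩ := torusMk_surjective y
    rw [toralMap_torusMk, ← sub_eq_zero, ← map_sub, torusMk_eq_zero_iff] at hy
    obtain ⟨k, hk⟩ := hy
    refine ⟨k, ?_⟩
    rw [← hk, add_sub_cancel, Matrix.mulVec_mulVec, Matrix.nonsing_inv_mul _ hunit,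
      Matrix.one_mulVec]
  · rintro ⟨k, rfl⟩
    rw [toralMap_torusMk, Matrix.mulVec_mulVec, Matrix.mul_nonsing_inv _ hunit, Matrix.one_mulVec,
      map_add, (torusMk_eq_zero_iff _).2 ⟨k, rfl⟩, add_zero]

theorem torusMk_inv_mulVec_eq_zero_iff {M : Matrix (Fin 2) (Fin 2) ℤ} (hM : M.det ≠ 0)
    (k : Fin 2 → ℤ) :
    torusMk ((M.map Int.cast)⁻¹.mulVec fun i => (k i : ℝ)) = 0 ↔ ∃ k', M.mulVec k' = k := by
  have hunit := isUnit_det_map_intCast hM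
  have hcast (k' : Fin 2 → ℤ) :
      (M.map (Int.cast : ℤ → ℝ)).mulVec (fun i => (k' i : ℝ)) = fun i => ((M.mulVec k') i : ℝ) :=
    funext fun i => (RingHom.map_mulVec (Int.castRingHom ℝ) M k' i).symm
  rw [torusMk_eq_zero_iff]
  refine exists_congr fun k' => ⟨fun hk' => ?_, ?_⟩
  · have hmul := hcast k'
    rw [← hk', Matrix.mulVec_mulVec, Matrix.mul_nonsing_inv _ hunit, Matrix.one_mulVec] at hmul
    ext i
    exact_mod_cast (congrFun hmul i).symm
  · rintro rfl
    rw [← hcast, Matrix.mulVec_mulVec, Matrix.nonsing_inv_mul _ hunit, Matrix.one_mulVec]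

theorem ncard_toralMap_preimage {M : Matrix (Fin 2) (Fin 2) ℤ} (hM : M.det ≠ 0) (t : Torus2) :
    {y | toralMap M y = t}.ncard = M.det.natAbs := by
  obtain ⟨z, rfl⟩ := torusMk_surjective t
  let A : Matrix (Fin 2) (Fin 2) ℝ := (M.map Int.cast)⁻¹
  let g : (Fin 2 → ℤ) →+ Torus2 := AddMonoidHom.mk'
    (fun k => torusMk (A.mulVec fun i => (k i : ℝ))) fun k k' => by
      rw [← map_add, ← Matrix.mulVec_add]; congr 2; ext i; simp
  have hfiber : {y | toralMap M y = torusMk z} =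
      (torusMk (A.mulVec z) + ·) '' (g.range : Set Torus2) := by
    ext y
    rw [Set.mem_ofPred_eq, toralMap_eq_torusMk_iff hM]
    simp only [Matrix.mulVec_add, map_add, Set.mem_image, SetLike.mem_coe, AddMonoidHom.mem_range,
      exists_exists_eq_and, @eq_comm _ y]
    rfl
  have hker : g.ker = (LinearMap.range (Matrix.toLin' M)).toAddSubgroup := by
    ext k
    exact torusMk_inv_mulVec_eq_zero_iff hM k
  have hinj : Function.Injective (Matrix.toLin' M) := Matrix.mulVec_injective_of_det_ne_zero hM
  calc {y | toralMap M y = torusMk z}.ncard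
      = g.ker.index := by
        rw [hfiber, Set.ncard_image_of_injective _ (add_right_injective _),
          ← Nat.card_coe_set_eq, AddSubgroup.index_ker]
        rfl
    _ = M.det.natAbs := by
        rw [hker, ← LinearMap.det_toLin']
        exact ((Submodule.natAbs_det_equiv _ (LinearEquiv.ofInjective _ hinj)).trans
          (Submodule.cardQuot_apply _)).symm

theorem ae_forall_toralMap_eq {M : Matrix (Fin 2) (Fin 2) ℤ} (hM : M.det ≠ 0)
    {Q : Torus2 → Prop} (hQ : ∀ᵐ z, Q (torusMk z)) :
    ∀ᵐ t : Torus2, ∀ y, toralMap M y = t → Q y := by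
  have hall : ∀ᵐ z, ∀ k : Fin 2 → ℤ,
      Q (torusMk ((M.map Int.cast)⁻¹.mulVec (z + fun i => (k i : ℝ)))) :=
    ae_all_iff.2 fun k => (measurePreserving_add_right volume _).quasiMeasurePreserving.ae
      (ae_mulVec (Matrix.isUnit_nonsing_inv_det _ (isUnit_det_map_intCast hM)).ne_zero hQ)
  refine ae_torus_of_ae_torusMk (hall.mono fun z hz y hy => ?_)
  obtain ⟨k, rfl⟩ := (toralMap_eq_torusMk_iff hM y z).1 hy
  exact hz k

/-- The rectangle containing the points `(fut, -past)` at a place where the automaton is in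
state `q`. -/
noncomputable def stateRect (σ : ℤ) (l c : ℝ) (q : Prop) : Set (Fin 2 → ℝ) :=
  Set.Icc ![0, -pastUpper l q] ![futBound σ c q, -pastLower σ l q]

/-- The set containing all points `(fut, -past)` of the symbolic compactum. -/
noncomputable def stateRects (σ : ℤ) (l c : ℝ) : Set (Fin 2 → ℝ) :=
  stateRect σ l c False ∪ stateRect σ l c True

namespace IsQuadraticUnit

variable {r : ℕ} {σ : ℤ} {l c : ℝ} (h : IsQuadraticUnit r σ l c)
include h

theorem volume_stateRects_le : volume (stateRects σ l c) ≤ ENNReal.ofReal (l - c) := by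
  refine (measure_union_le _ _).trans (le_of_eq ?_)
  have hopen : (0 : ℝ) ≤ (1 + σ) / 2 - c := by
    simpa [futBound] using (h.futBound_mem_Ioc True).1.le
  have hclosed : (0 : ℝ) ≤ l - 1 - (σ - 1) / 2 := by
    have := h.one_lt
    rcases h.sigma_eq_or with hσ | hσ <;> rw [hσ] <;> push_cast <;> linarith
  simp only [stateRect, Real.volume_Icc_pi, Fin.prod_univ_two, Matrix.cons_val_zero,
    Matrix.cons_val_one, futBound, pastLower, pastUpper, if_false, if_true, sub_zero,
    ENNReal.ofReal_one, one_mul, neg_sub_neg, sub_sub_cancel, mul_one]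
  rw [← ENNReal.ofReal_add hclosed hopen]
  congr 1; ring

theorem fut_past_mem_stateRects {ε : PrimarySet l} (hε : ε ∈ symbolicCompactum l r σ) :
    ![fut l ε.1 0, -past c ε.1 0] ∈ stateRects σ l c := by
  obtain ⟨q, hq⟩ := exists_labelling h.sigma_eq_or hε
  obtain ⟨hlower, hupper⟩ := h.past_mem_Icc hε hq 0
  have hfut := h.fut_le_futBound hε hq 0
  have hnonneg := fut_nonneg h.pos ε.1 0
  have hmem : ![fut l ε.1 0, -past c ε.1 0] ∈ stateRect σ l c (q 0) := by
    simp only [stateRect, Set.mem_Icc, Pi.le_def, Fin.forall_fin_two, Matrix.cons_val_zero,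
      Matrix.cons_val_one]
    exact ⟨⟨hnonneg, neg_le_neg hupper⟩, hfut, neg_le_neg hlower⟩
  by_cases hq0 : q 0 <;> simp only [hq0] at hmem
  exacts [.inr hmem, .inl hmem]

theorem exists_minkowskiBasis :
    ∃ b : Module.Basis (Fin 2) ℝ (Fin 2 → ℝ), ⇑b = ![![1, 1], ![l, c]] := by
  have hdet : (!![1, 1; l, c] : Matrix (Fin 2) (Fin 2) ℝ).det ≠ 0 := by
    rw [Matrix.det_fin_two_of]; linarith [h.sub_pos]
  exact ⟨basisOfLinearIndependentOfCardEqFinrank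
    (Matrix.linearIndependent_rows_of_det_ne_zero hdet) (by simp), by simp; rfl⟩

theorem volume_fundamentalDomain_minkowski {b : Module.Basis (Fin 2) ℝ (Fin 2 → ℝ)}
    (hb : ⇑b = ![![1, 1], ![l, c]]) :
    volume (ZSpan.fundamentalDomain b) = ENNReal.ofReal (l - c) := by
  have hdet : |(Matrix.of ![![1, 1], ![l, c]]).det| = l - c := by
    rw [Matrix.det_fin_two_of, one_mul, one_mul, abs_sub_comm, abs_of_pos h.sub_pos]
  rw [ZSpan.volume_fundamentalDomain, hb, hdet]

theorem mem_span_minkowski_iff (v : Fin 2 → ℝ) :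
    v ∈ Submodule.span ℤ (Set.range ![![1, 1], ![l, c]]) ↔ eigenMk l c (v 0, v 1) = 0 := by
  rw [h.eigenMk_eq_zero_iff, Matrix.range_cons, Matrix.range_cons, Matrix.range_empty,
    Set.union_empty, Set.singleton_union, Submodule.mem_span_pair]
  refine exists₂_congr fun m n => ?_
  simp [funext_iff, Fin.forall_fin_two, Prod.ext_iff, eq_comm]

theorem fut_past_notMem_quadInts {ε : PrimarySet l} {x y : ℝ}
    (he : coding l c 1 0 ε = eigenMk l c (x, y)) (hx : x ∉ quadInts l) (hy : y ∉ quadInts c) :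
    fut l ε.1 0 ∉ quadInts l ∧ past c ε.1 0 ∉ quadInts c := by
  obtain ⟨m, n, hmn⟩ := (h.eigenMk_eq_iff _ _).1 he
  have hfut := congrArg Prod.fst hmn
  have hpast := congrArg Prod.snd hmn
  simp only [Int.cast_one, Int.cast_zero, zero_mul, add_zero, one_mul, Prod.mk_add_mk]
    at hfut hpast
  constructor
  · rintro ⟨⟨a, b⟩, hab⟩
    exact hx ⟨(a - m, b - n), by simp only at hab ⊢; push_cast; linarith⟩
  · rintro ⟨⟨a, b⟩, hab⟩
    exact hy ⟨(-a - m, -b - n), by simp only at hab ⊢; push_cast; linarith⟩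

theorem ae_existsUnique_coding :
    ∀ᵐ w : Fin 2 → ℝ, ∃! ε, ε ∈ symbolicCompactum l r σ ∧
      coding l c 1 0 ε = eigenMk l c (w 0, w 1) := by
  obtain ⟨b, hb⟩ := h.exists_minkowskiBasis
  let L := (Submodule.span ℤ (Set.range b)).toAddSubgroup
  have : Countable L := inferInstanceAs (Countable (Submodule.span ℤ (Set.range b)))
  have hvol := h.volume_fundamentalDomain_minkowski hb
  have exists_translate {ε : PrimarySet l} {w : Fin 2 → ℝ}
      (he : coding l c 1 0 ε = eigenMk l c (w 0, w 1)) :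
      ∃ g : L, g +ᵥ w = ![fut l ε.1 0, -past c ε.1 0] := by
    refine ⟨⟨![fut l ε.1 0, -past c ε.1 0] - w, ?_⟩, sub_add_cancel _ _⟩
    rw [Submodule.mem_toAddSubgroup, hb, h.mem_span_minkowski_iff]
    simpa [coding, sub_eq_zero, ← Prod.mk_sub_mk] using he
  have exists_code (w : Fin 2 → ℝ) :
      ∃ ε ∈ symbolicCompactum l r σ, coding l c 1 0 ε = eigenMk l c (w 0, w 1) := by
    have hmem := Set.mem_univ (eigenMk l c (w 0, w 1))
    rwa [← h.image_coding_symbolicCompactum (m := 1) (n := 0) (by simp)] at hmem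
  have hcov (w : Fin 2 → ℝ) : ∃ g : L, g +ᵥ w ∈ stateRects σ l c := by
    obtain ⟨ε, hε, he⟩ := exists_code w
    obtain ⟨g, hg⟩ := exists_translate he
    exact ⟨g, hg ▸ h.fut_past_mem_stateRects hε⟩
  filter_upwards [ae_existsUnique_vadd_mem (ZSpan.isAddFundamentalDomain' b volume)
      (measurableSet_Icc.union measurableSet_Icc)
      (hvol ▸ h.volume_stateRects_le) (by simp [hvol]) hcov,
    ae_notMem_countable 0 (countable_quadInts l),
    ae_notMem_countable 1 (countable_quadInts c)] with w hw hw0 hw1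
  obtain ⟨ε, hε, he⟩ := exists_code w
  refine ⟨ε, ⟨hε, he⟩, fun ε' ⟨hε', he'⟩ => ?_⟩
  obtain ⟨g, hg⟩ := exists_translate he
  obtain ⟨g', hg'⟩ := exists_translate he'
  obtain rfl := hw.unique (hg' ▸ h.fut_past_mem_stateRects hε')
    (hg ▸ h.fut_past_mem_stateRects hε)
  have hnotMem := h.fut_past_notMem_quadInts he' hw0 hw1
  have hpoint := hg'.symm.trans hg
  refine h.eq_of_fut_eq_of_past_eq hε' hε (congrFun hpoint 0)
    (neg_injective (congrFun hpoint 1)) hnotMem.1 hnotMem.2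

theorem ae_torusMk_of_ae_eigenMk {Q : Torus2 → Prop}
    (hQ : ∀ᵐ w : Fin 2 → ℝ, Q (eigenMk l c (w 0, w 1))) : ∀ᵐ z, Q (torusMk z) := by
  have hdet : (!![l, 1; c, 1] : Matrix (Fin 2) (Fin 2) ℝ).det ≠ 0 := by
    rw [Matrix.det_fin_two_of]; linarith [h.sub_pos]
  filter_upwards [ae_mulVec hdet hQ] with z hz
  rw [← h.eigenMk_eq_torusMk z]
  simpa [Matrix.mulVec, dotProduct, Fin.sum_univ_two] using hz

theorem ae_ncard_coding {m n : ℤ} (hmn : (m, n) ≠ (0, 0)) :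
    ∀ᵐ t : Torus2, {ε | ε ∈ symbolicCompactum l r σ ∧ coding l c m n ε = t}.ncard =
      (quadNorm r σ m n).natAbs := by
  have hdet := h.det_mulMatrix_ne_zero hmn
  let Q (y : Torus2) : Prop := ∃! ε, ε ∈ symbolicCompactum l r σ ∧ coding l c 1 0 ε = y
  have hQ : ∀ᵐ z, Q (torusMk z) := h.ae_torusMk_of_ae_eigenMk h.ae_existsUnique_coding
  filter_upwards [ae_forall_toralMap_eq hdet hQ] with t ht
  rw [← det_mulMatrix, ← ncard_toralMap_preimage hdet t]
  refine Set.ncard_congr (fun ε _ => coding l c 1 0 ε) (fun ε hε => ?_) (fun ε ε' hε hε' he => ?_)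
    fun y hy => ?_
  · exact (h.coding_eq_toralMap m n ε).symm.trans hε.2
  · exact (ht _ ((h.coding_eq_toralMap m n ε).symm.trans hε.2)).unique ⟨hε.1, rfl⟩
      ⟨hε'.1, he.symm⟩
  · obtain ⟨ε, hε, rfl⟩ := (ht y hy).exists
    exact ⟨ε, ⟨hε, (h.coding_eq_toralMap m n ε).trans hy⟩, rfl⟩

theorem ae_existsUnique_of_quadNorm {m n : ℤ} (hN : |quadNorm r σ m n| = 1) :
    ∀ᵐ t : Torus2, ∃! ε, ε ∈ symbolicCompactum l r σ ∧ coding l c m n ε = t := by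
  have hmn : (m, n) ≠ (0, 0) := by
    rintro ⟨⟩
    simp [quadNorm] at hN
  filter_upwards [h.ae_ncard_coding hmn] with t ht
  rw [Int.abs_eq_natAbs, Nat.cast_eq_one] at hN
  rw [hN, Set.ncard_eq_one] at ht
  exact Set.singleton_iff_unique_mem.1 ht

end IsQuadraticUnit

/-! ### Equivariant maps are codings -/

/-- The sequence with the single nonzero digit `1` at place `k`. -/
def singleSeq (l : ℝ) (k : ℤ) : PrimarySet l :=
  ⟨Pi.single k 1, mem_of_finite_support ((Set.finite_singleton k).subset Pi.support_single_subset)⟩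

theorem singleSeq_apply (l : ℝ) (k j : ℤ) : (singleSeq l k).1 j = if j = k then 1 else 0 :=
  Pi.single_apply k 1 j

theorem shift_singleSeq (l : ℝ) (k : ℤ) : shift (singleSeq l (k + 1)) = singleSeq l k := by
  ext j
  simp [shift, singleSeq_apply]

theorem sum_singleSeq_apply {l : ℝ} (ε : ℤ → ℕ) (s : Finset ℤ) (j : ℤ) :
    (∑ k ∈ s, ε k • singleSeq l k).1 j = if j ∈ s then ε j else 0 := by
  have hterm (k : ℤ) : (ε k • singleSeq l k).1 j = if j = k then ε k else 0 := by
    change ε k • (singleSeq l k).1 j = _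
    rw [singleSeq_apply]; split_ifs <;> simp
  rw [show (∑ k ∈ s, ε k • singleSeq l k).1 = ∑ k ∈ s, (ε k • singleSeq l k).1 from
    map_sum (PrimarySet l).subtype _ s, Finset.sum_apply]
  simp only [hterm, Finset.sum_ite_eq]

theorem tendsto_sum_singleSeq {l : ℝ} (ε : PrimarySet l) :
    Tendsto (fun N : ℕ => ∑ k ∈ Finset.Icc (-(N : ℤ)) N, ε.1 k • singleSeq l k) atTop
      (𝓝[{ε' | ∀ n, ε'.1 n ≤ ε.1 n}] ε) := by
  refine tendsto_nhdsWithin_iff.2 ⟨tendsto_subtype_rng.2 (tendsto_pi_nhds.2 fun j => ?_),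
    .of_forall fun N j => ?_⟩
  · refine tendsto_const_nhds.congr' ?_
    filter_upwards [eventually_ge_atTop j.natAbs] with N hN
    rw [sum_singleSeq_apply, if_pos]
    rw [Finset.mem_Icc]; omega
  · rw [sum_singleSeq_apply]
    split_ifs <;> simp

theorem tendsto_singleSeq {l : ℝ} (hl : 1 < l) {f : ℕ → ℤ} (hf : Function.Injective f) :
    Tendsto (fun k => singleSeq l (f k)) atTop (𝓝[{ε | ∀ n, ε.1 n ≤ (constSeq hl 1).1 n}] 0) := by
  refine tendsto_nhdsWithin_iff.2 ⟨tendsto_subtype_rng.2 (tendsto_pi_nhds.2 fun j => ?_),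
    .of_forall fun k n => ?_⟩
  · refine tendsto_const_nhds.congr' ?_
    have hne : ∀ᶠ k in atTop, f k ∉ ({j} : Set ℤ) := by
      rw [← Nat.cofinite_eq_atTop]
      exact ((Set.finite_singleton j).preimage hf.injOn).eventually_cofinite_notMem
    filter_upwards [hne] with k hk
    rw [singleSeq_apply, if_neg (Ne.symm hk)]
    rfl
  · rw [singleSeq_apply]
    simp only [constSeq]
    split_ifs <;> simp

/-- The conditions on `φ` alone in the definition of an arithmetic coding. -/
structure IsEquivariant {l : ℝ} (M : Matrix (Fin 2) (Fin 2) ℤ) (φ : PrimarySet l → Torus2) :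
    Prop where
  map_add : ∀ ε ε', φ (ε + ε') = φ ε + φ ε'
  continuousOn : ∀ w : PrimarySet l, ContinuousOn φ {ε | ∀ n, ε.1 n ≤ w.1 n}
  map_shift : ∀ ε, φ (shift ε) = toralMap M (φ ε)

namespace IsEquivariant

variable {l : ℝ} {M : Matrix (Fin 2) (Fin 2) ℤ} {φ ψ : PrimarySet l → Torus2}

theorem map_zero (hφ : IsEquivariant M φ) : φ 0 = 0 := by
  simpa using hφ.map_add 0 0

theorem toralMap_map_singleSeq (hφ : IsEquivariant M φ) (k : ℤ) :
    toralMap M (φ (singleSeq l (k + 1))) = φ (singleSeq l k) := by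
  rw [← hφ.map_shift, shift_singleSeq]

theorem tendsto_map_singleSeq (hφ : IsEquivariant M φ) (hl : 1 < l) {f : ℕ → ℤ}
    (hf : Function.Injective f) : Tendsto (fun k => φ (singleSeq l (f k))) atTop (𝓝 0) := by
  rw [← hφ.map_zero]
  exact (hφ.continuousOn (constSeq hl 1) 0 fun _ => Nat.zero_le _).tendsto.comp
    (tendsto_singleSeq hl hf)

theorem map_nsmul (hφ : IsEquivariant M φ) (a : ℕ) (ε : PrimarySet l) : φ (a • ε) = a • φ ε :=
  (AddMonoidHom.mk' φ hφ.map_add).map_nsmul a ε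

theorem map_sum {ι : Type*} (hφ : IsEquivariant M φ) (s : Finset ι) (f : ι → PrimarySet l) :
    φ (∑ i ∈ s, f i) = ∑ i ∈ s, φ (f i) :=
  _root_.map_sum (AddMonoidHom.mk' φ hφ.map_add) f s

theorem ext (hφ : IsEquivariant M φ) (hψ : IsEquivariant M ψ)
    (hM : Function.Injective (toralMap M)) (h0 : φ (singleSeq l 0) = ψ (singleSeq l 0)) :
    φ = ψ := by
  have hsingle (k : ℤ) : φ (singleSeq l k) = ψ (singleSeq l k) := by
    induction k with
    | zero => exact h0
    | succ k ih => exact hM (by rw [hφ.toralMap_map_singleSeq, hψ.toralMap_map_singleSeq, ih])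
    | pred k ih =>
      rw [← hφ.toralMap_map_singleSeq, ← hψ.toralMap_map_singleSeq, sub_add_cancel, ih]
  funext ε
  have hlim {χ : PrimarySet l → Torus2} (hχ : IsEquivariant M χ) :=
    (hχ.continuousOn ε ε fun _ => le_rfl).tendsto.comp (tendsto_sum_singleSeq ε)
  refine tendsto_nhds_unique (hlim hφ) ((hlim hψ).congr fun N => ?_)
  simp only [Function.comp, hφ.map_sum, hψ.map_sum, hφ.map_nsmul, hψ.map_nsmul, hsingle]

end IsEquivariant

theorem eq_zero_of_tendsto_of_eq_mul {x : ℕ → ℝ} {q : ℝ} (hq : |q| < 1)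
    (hx : Tendsto x atTop (𝓝 0)) (hstep : ∀ k, x k = q * x (k + 1)) : x 0 = 0 := by
  have hiter (k : ℕ) : x 0 = q ^ k * x k := by
    induction k with
    | zero => simp
    | succ k ih => rw [ih, hstep k]; ring
  have hlim := (tendsto_pow_atTop_nhds_zero_of_abs_lt_one hq).mul hx
  simp only [← hiter, mul_zero] at hlim
  exact tendsto_nhds_unique tendsto_const_nhds hlim

namespace IsQuadraticUnit

variable {r : ℕ} {σ : ℤ} {l c : ℝ} (h : IsQuadraticUnit r σ l c)
include h

theorem isEquivariant_coding (m n : ℤ) :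
    IsEquivariant (companionMatrix r σ) (coding l c m n) :=
  ⟨h.coding_add m n, h.continuousOn_coding m n, h.coding_shift m n⟩

theorem exists_eigenMk_eq_and_norm_le (t : Torus2) :
    ∃ p, eigenMk l c p = t ∧ ‖p‖ ≤ (l + 1) * ‖t‖ := by
  have hrep (a : UnitAddCircle) : ∃ x : ℝ, (x : UnitAddCircle) = a ∧ |x| = ‖a‖ := by
    obtain ⟨y, rfl⟩ := QuotientAddGroup.mk_surjective a
    refine ⟨y - round y, ?_, (UnitAddCircle.norm_eq (x := y)).symm⟩
    rw [AddCircle.coe_sub, (AddCircle.coe_eq_zero_iff 1 (x := (round y : ℝ))).2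
      ⟨round y, by simp⟩, sub_zero]
  choose z hz hnorm using fun i => hrep (t i)
  have hcoord (i : Fin 2) : |z i| ≤ ‖t‖ := (hnorm i).le.trans (norm_le_pi_norm t i)
  have hbound {a : ℝ} (ha : |a| ≤ l) : |a * z 0 + z 1| ≤ (l + 1) * ‖t‖ :=
    calc |a * z 0 + z 1| ≤ |a| * |z 0| + |z 1| := (abs_add_le _ _).trans_eq (by rw [abs_mul])
      _ ≤ l * ‖t‖ + ‖t‖ := by
        gcongr
        exacts [h.pos.le, hcoord 0, hcoord 1]
      _ = (l + 1) * ‖t‖ := by ring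
  refine ⟨(l * z 0 + z 1, c * z 0 + z 1), ?_, norm_prod_le_iff.2
    ⟨hbound (abs_of_pos h.pos).le, hbound (h.abs_conj_lt_one.le.trans h.one_lt.le)⟩⟩
  rw [h.eigenMk_eq_torusMk]
  exact funext hz

theorem exists_tendsto_zero_lift {u : ℕ → Torus2} (hu : Tendsto u atTop (𝓝 0)) :
    ∃ p : ℕ → ℝ × ℝ, (∀ k, eigenMk l c (p k) = u k) ∧ Tendsto p atTop (𝓝 0) := by
  choose p hp hle using fun k => h.exists_eigenMk_eq_and_norm_le (u k)
  exact ⟨p, hp, squeeze_zero_norm hle (by simpa using hu.norm.const_mul (l + 1))⟩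

theorem exists_lattice_gap : ∃ δ > 0, ∀ m n : ℤ,
    ‖((m : ℝ) + n * l, (m : ℝ) + n * c)‖ < δ → m = 0 ∧ n = 0 := by
  have hs := h.sub_pos
  refine ⟨min 1 ((l - c) / 2), by positivity, fun m n hmn => ?_⟩
  obtain ⟨hone, hhalf⟩ := lt_min_iff.1 hmn
  have hl := norm_fst_le ((m : ℝ) + n * l, (m : ℝ) + n * c)
  have hc := norm_snd_le ((m : ℝ) + n * l, (m : ℝ) + n * c)
  have hn : |(n : ℝ)| * (l - c) < 1 * (l - c) :=
    calc |(n : ℝ)| * (l - c) = |((m : ℝ) + n * l) - (m + n * c)| := by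
          rw [add_sub_add_left_eq_sub, ← mul_sub, abs_mul, abs_of_pos hs]
      _ ≤ |(m : ℝ) + n * l| + |(m : ℝ) + n * c| := abs_sub _ _
      _ < 1 * (l - c) := by simp only [Real.norm_eq_abs] at *; linarith
  obtain rfl : n = 0 := Int.abs_lt_one_iff.1 (by exact_mod_cast lt_of_mul_lt_mul_right hn hs.le)
  simp only [Int.cast_zero, zero_mul, add_zero] at hl hone
  rw [Real.norm_eq_abs] at hl
  exact ⟨Int.abs_lt_one_iff.1 (by exact_mod_cast hl.trans_lt hone), rfl⟩

theorem eventually_eq_linear {p q : ℕ → ℝ × ℝ} (hp : Tendsto p atTop (𝓝 0))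
    (hq : Tendsto q atTop (𝓝 0))
    (hpq : ∀ k, toralMap (companionMatrix r σ) (eigenMk l c (p k)) = eigenMk l c (q k)) :
    ∀ᶠ k in atTop, q k = (l * (p k).1, c * (p k).2) := by
  obtain ⟨δ, hδ, hgap⟩ := h.exists_lattice_gap
  have hlinear : Tendsto (fun k => (l * (p k).1, c * (p k).2)) atTop (𝓝 0) := by
    have hcont : Continuous fun x : ℝ × ℝ => (l * x.1, c * x.2) := by fun_prop
    exact (hcont.tendsto' 0 0 (by simp)).comp hp
  have hsub := (hq.sub hlinear).norm
  rw [sub_zero, norm_zero] at hsub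
  filter_upwards [hsub.eventually_lt_const hδ] with k hk
  have heq := (hpq k).symm
  rw [h.toralMap_companionMatrix, h.eigenMk_eq_iff] at heq
  obtain ⟨m, n, hmn⟩ := heq
  rw [hmn, add_sub_cancel_left] at hk
  obtain ⟨rfl, rfl⟩ := hgap m n hk
  simpa using hmn

theorem exists_eq_unstable {u : ℕ → Torus2} (hu : Tendsto u atTop (𝓝 0))
    (hstep : ∀ k, toralMap (companionMatrix r σ) (u (k + 1)) = u k) :
    ∃ x, u 0 = eigenMk l c (x, 0) := by
  obtain ⟨p, hp, hlim⟩ := h.exists_tendsto_zero_lift hu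
  obtain ⟨K, hK⟩ := eventually_atTop.1 <| h.eventually_eq_linear
    ((tendsto_add_atTop_iff_nat 1).2 hlim) hlim fun k => by rw [hp, hp, hstep]
  have hzero : (p (0 + K)).2 = 0 :=
    eq_zero_of_tendsto_of_eq_mul (x := fun k => (p (k + K)).2) h.abs_conj_lt_one
      ((tendsto_add_atTop_iff_nat K).2 hlim).snd_nhds fun k => by
        rw [hK (k + K) (by omega), show k + 1 + K = k + K + 1 by ring]
  have hiter : (toralMap (companionMatrix r σ))^[K] (u K) = u 0 := by
    clear hK hzero
    induction K with
    | zero => rfl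
    | succ K ih => rw [Function.iterate_succ_apply, hstep, ih]
  rw [zero_add] at hzero
  exact ⟨l ^ K * (p K).1, by
    rw [← hiter, ← hp, h.iterate_toralMap_companionMatrix, hzero, mul_zero]⟩

theorem exists_eq_stable {u : ℕ → Torus2} (hu : Tendsto u atTop (𝓝 0))
    (hstep : ∀ k, toralMap (companionMatrix r σ) (u k) = u (k + 1)) :
    ∃ y, u 0 = eigenMk l c (0, y) := by
  obtain ⟨p, hp, hlim⟩ := h.exists_tendsto_zero_lift hu
  obtain ⟨K, hK⟩ := eventually_atTop.1 <| h.eventually_eq_linear hlim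
    ((tendsto_add_atTop_iff_nat 1).2 hlim) fun k => by rw [hp, hp, hstep]
  have hzero : (p (0 + K)).1 = 0 :=
    eq_zero_of_tendsto_of_eq_mul (x := fun k => (p (k + K)).1) (q := l⁻¹)
      (by rw [abs_of_pos (inv_pos.2 h.pos)]; exact inv_lt_one_of_one_lt₀ h.one_lt)
      ((tendsto_add_atTop_iff_nat K).2 hlim).fst_nhds fun k => by
        rw [show k + 1 + K = k + K + 1 by ring, hK (k + K) (by omega),
          inv_mul_cancel_left₀ h.pos.ne']
  have hiter : (toralMap (companionMatrix r σ))^[K] (u 0) = u K := by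
    clear hK hzero
    induction K with
    | zero => rfl
    | succ K ih => rw [Function.iterate_succ_apply', ih, hstep]
  rw [zero_add] at hzero
  refine ⟨(p K).2 / c ^ K, h.toralMap_companionMatrix_injective.iterate K ?_⟩
  rw [hiter, h.iterate_toralMap_companionMatrix, ← hp,
    mul_div_cancel₀ _ (pow_ne_zero K h.conj_ne_zero), mul_zero, ← hzero]

theorem exists_homoclinic {φ : PrimarySet l → Torus2}
    (hφ : IsEquivariant (companionMatrix r σ) φ) :
    ∃ m n : ℤ, φ (singleSeq l 0) = eigenMk l c ((m : ℝ) + n * l, 0) := by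
  obtain ⟨x, hx⟩ := h.exists_eq_unstable
    (hφ.tendsto_map_singleSeq h.one_lt (f := fun k => k) Nat.cast_injective)
    fun k => by exact_mod_cast hφ.toralMap_map_singleSeq k
  obtain ⟨y, hy⟩ := h.exists_eq_stable
    (hφ.tendsto_map_singleSeq h.one_lt (f := fun k => -k) (neg_injective.comp Nat.cast_injective))
    fun k => by simpa using hφ.toralMap_map_singleSeq (-((k + 1 : ℕ) : ℤ))
  simp only [Nat.cast_zero, neg_zero] at hx hy
  obtain ⟨m, n, hmn⟩ := (h.eigenMk_eq_iff _ _).1 (hx.symm.trans hy)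
  refine ⟨m, n, ?_⟩
  rw [hx, show x = m + n * l by simpa using congrArg Prod.fst hmn]

theorem coding_singleSeq_zero (m n : ℤ) :
    coding l c m n (singleSeq l 0) = eigenMk l c ((m : ℝ) + n * l, 0) := by
  have hfut : fut l (singleSeq l 0).1 0 = 0 := by
    refine (tsum_congr fun k => ?_).trans tsum_zero
    rw [singleSeq_apply, if_neg (by omega), Nat.cast_zero, zero_div]
  have hpast : past c (singleSeq l 0).1 0 = 1 := by
    refine (tsum_eq_single 0 fun k hk => ?_).trans (by simp [singleSeq_apply])
    rw [singleSeq_apply, if_neg (by omega), Nat.cast_zero, zero_mul]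
  rw [coding, hfut, hpast, eq_comm, h.eigenMk_eq_iff]
  exact ⟨m, n, by ext <;> simp⟩

theorem exists_eq_coding {φ : PrimarySet l → Torus2}
    (hφ : IsEquivariant (companionMatrix r σ) φ) : ∃ m n : ℤ, φ = coding l c m n := by
  obtain ⟨m, n, h0⟩ := h.exists_homoclinic hφ
  exact ⟨m, n, hφ.ext (h.isEquivariant_coding m n) h.toralMap_companionMatrix_injective
    (h0.trans (h.coding_singleSeq_zero m n).symm)⟩

end IsQuadraticUnit

/-! ### Total sets -/

/-- The one-sided sequence `ε_n, ε_{n+1}, …`. -/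
def tail (ε : ℤ → ℕ) (n : ℤ) : ℕ → ℕ := fun j => ε (n + j)

theorem LexLess.trans {a b c : ℕ → ℕ} (hab : LexLess a b) (hbc : LexLess b c) : LexLess a c := by
  obtain ⟨n, hn, hn'⟩ := hab
  obtain ⟨m, hm, hm'⟩ := hbc
  rcases lt_trichotomy n m with hlt | rfl | hlt
  · exact ⟨n, (hm' n hlt) ▸ hn, fun k hk => (hn' k hk).trans (hm' k (hk.trans hlt))⟩
  · exact ⟨n, hn.trans hm, fun k hk => (hn' k hk).trans (hm' k hk)⟩
  · exact ⟨m, (hn' m hlt).symm ▸ hm, fun k hk => (hn' k (hk.trans hlt)).trans (hm' k hk)⟩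

theorem LexLess.of_head {a b : ℕ → ℕ} (h : a 0 < b 0) : LexLess a b :=
  ⟨0, h, fun _ hm => absurd hm (Nat.not_lt_zero _)⟩

theorem LexLess.of_second {a b : ℕ → ℕ} (h0 : a 0 ≤ b 0) (h1 : a 1 < b 1) : LexLess a b := by
  rcases h0.lt_or_eq with h0 | h0
  · exact .of_head h0
  · exact ⟨1, h1, fun m hm => by rwa [Nat.lt_one_iff.1 hm]⟩

theorem le_of_not_lexLess {a b : ℕ → ℕ} (hab : ¬ LexLess a b) {n : ℕ}
    (heq : ∀ m < n, a m = b m) : b n ≤ a n :=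
  not_lt.1 fun hn => hab ⟨n, hn, heq⟩

theorem toralMap_companionMatrix_sq (r : ℕ) (σ : ℤ) (t : Torus2) :
    toralMap (companionMatrix r σ) (toralMap (companionMatrix r σ) t) + σ • t =
      r • toralMap (companionMatrix r σ) t := by
  ext i
  fin_cases i <;> (simp [toralMap, companionMatrix, Fin.sum_univ_two] <;> module)

/-- The word `r 1`, which for `σ = -1` carries to the digit `1` one place to the left. -/
def negWord (l : ℝ) (r : ℕ) : PrimarySet l := r • singleSeq l 0 + singleSeq l 1

theorem negWord_apply (l : ℝ) (r : ℕ) (k : ℤ) :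
    (negWord l r).1 k = (if k = 0 then r else 0) + if k = 1 then 1 else 0 := by
  change r • (singleSeq l 0).1 k + (singleSeq l 1).1 k = _
  simp [singleSeq_apply]

/-- The word `(r-1) (r-2)^j (r-1)`, which for `σ = 1` carries to the digits `1` on either side
of it. -/
def posWord (l : ℝ) (r j : ℕ) : PrimarySet l :=
  (r - 1) • singleSeq l 0 + ∑ i ∈ Finset.range j, (r - 2) • singleSeq l (i + 1) +
    (r - 1) • singleSeq l (j + 1)

theorem posWord_apply (l : ℝ) (r j : ℕ) (k : ℤ) : (posWord l r j).1 k =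
    if k = 0 ∨ k = j + 1 then r - 1 else if 0 < k ∧ k ≤ j then r - 2 else 0 := by
  have hsum : (∑ i ∈ Finset.range j, (r - 2) • singleSeq l (i + 1)).1 k =
      if 0 < k ∧ k ≤ j then r - 2 else 0 := by
    induction j with
    | zero => rw [if_neg (by omega)]; rfl
    | succ j ih =>
      rw [Finset.sum_range_succ, AddSubmonoid.coe_add, Pi.add_apply, ih]
      change _ + (r - 2) • (singleSeq l (j + 1)).1 k = _
      rw [singleSeq_apply]
      push_cast
      split_ifs <;> first | omega | simp
  change (r - 1) • (singleSeq l 0).1 k + _ + (r - 1) • (singleSeq l (j + 1)).1 k = _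
  rw [hsum, singleSeq_apply, singleSeq_apply]
  split_ifs <;> first | omega | simp

theorem finite_support_of_Icc {ε : ℤ → ℕ} (a b : ℤ) (hε : ∀ k, k < a ∨ b < k → ε k = 0) :
    (Function.support ε).Finite :=
  (Set.finite_Icc a b).subset fun k hk => by
    by_contra hout
    rw [Set.mem_Icc, not_and_or, not_le, not_le] at hout
    exact hk (hε k hout)

theorem posWord_relation {A : Type*} [AddCommGroup A] {a : ℤ → A} {r : ℕ} (hr : 2 ≤ r)
    (ha : ∀ k, a (k - 1) + a (k + 1) = r • a k) (j : ℕ) :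
    (r - 1) • a 0 + ∑ i ∈ Finset.range j, (r - 2) • a (i + 1) + (r - 1) • a (j + 1) =
      a (-1) + a (j + 2) := by
  obtain ⟨s, rfl⟩ := Nat.exists_eq_add_of_le' hr
  simp only [Nat.add_sub_cancel, show s + 2 - 1 = s + 1 from rfl]
  induction j with
  | zero =>
    have h0 := ha 0
    have h1 := ha 1
    norm_num at h0 h1 ⊢
    linear_combination (norm := module) -(1 : ℤ) • h0 - (1 : ℤ) • h1
  | succ j ih =>
    have hj := ha (j + 2)
    rw [Finset.sum_range_succ]
    push_cast
    rw [show (j : ℤ) + 2 - 1 = j + 1 by ring, show (j : ℤ) + 2 + 1 = j + 3 by ring] at hj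
    rw [show (j : ℤ) + 1 + 1 = j + 2 by ring, show (j : ℤ) + 1 + 2 = j + 3 by ring]
    linear_combination (norm := module) (1 : ℤ) • ih - (1 : ℤ) • hj

namespace IsEquivariant

variable {l : ℝ} {r : ℕ} {σ : ℤ} {φ : PrimarySet l → Torus2}

theorem singleSeq_relation (hφ : IsEquivariant (companionMatrix r σ) φ) (k : ℤ) :
    φ (singleSeq l (k - 1)) + σ • φ (singleSeq l (k + 1)) = r • φ (singleSeq l k) := by
  rw [← hφ.toralMap_map_singleSeq (k - 1), sub_add_cancel, ← hφ.toralMap_map_singleSeq k,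
    toralMap_companionMatrix_sq]

theorem map_negWord (hφ : IsEquivariant (companionMatrix r (-1)) φ) :
    φ (negWord l r) = φ (singleSeq l (-1)) := by
  rw [negWord, hφ.map_add, hφ.map_nsmul, ← hφ.singleSeq_relation 0]
  simp

theorem map_posWord (hφ : IsEquivariant (companionMatrix r 1) φ) (hr : 2 ≤ r) (j : ℕ) :
    φ (posWord l r j) = φ (singleSeq l (-1) + singleSeq l (j + 2)) := by
  simp only [posWord, hφ.map_add, hφ.map_sum, hφ.map_nsmul]
  exact posWord_relation (a := fun k => φ (singleSeq l k)) hr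
    (fun k => by simpa using hφ.singleSeq_relation k) j

end IsEquivariant

section

variable {l : ℝ} {r : ℕ} {φ : PrimarySet l → Torus2} {X : Set (PrimarySet l)}
  (hX : IsTotalSet X) (hinj : Set.InjOn φ {ε | ε ∈ X ∧ (Function.support ε.1).Finite})
include hX hinj

/- Totality would put both `f` and `g` into `X`. -/
theorem not_lexLess_of_map_eq {f g : PrimarySet l} (hfg : φ f = φ g) (hne : f ≠ g)
    (hf : (Function.support f.1).Finite) (hg : (Function.support g.1).Finite)
    (hftail : ∀ k ≠ 0, LexLess (tail f.1 k) (tail f.1 0))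
    (hgtail : ∀ k, LexLess (tail g.1 k) (tail f.1 0)) {ε : PrimarySet l} (hε : ε ∈ X) (n : ℤ) :
    ¬ LexLess (tail f.1 0) (tail ε.1 n) := fun hlt => by
  have hfX : f ∈ X := hX ε hε f ⟨n, fun k => by
    rcases eq_or_ne k 0 with rfl | hk
    exacts [hlt, (hftail k hk).trans hlt]⟩
  have hgX : g ∈ X := hX ε hε g ⟨n, fun k => (hgtail k).trans hlt⟩
  exact hne (hinj ⟨hfX, hf⟩ ⟨hgX, hg⟩ hfg)

theorem not_lexLess_negWord (hφ : IsEquivariant (companionMatrix r (-1)) φ) (hr : 1 ≤ r)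
    {ε : PrimarySet l} (hε : ε ∈ X) (n : ℤ) : ¬ LexLess (tail (negWord l r).1 0) (tail ε.1 n) := by
  refine not_lexLess_of_map_eq hX hinj hφ.map_negWord (fun heq => ?_) ?_ ?_ (fun k hk => ?_)
    (fun k => ?_) hε n
  · have := congrArg (fun ε : PrimarySet l => ε.1 (-1)) heq
    simp [negWord_apply, singleSeq_apply] at this
  · exact finite_support_of_Icc 0 1 fun k hk => by
      rw [negWord_apply, if_neg (by omega), if_neg (by omega)]
  · exact finite_support_of_Icc (-1) (-1) fun k hk => by
      rw [singleSeq_apply, if_neg (by omega)]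
  · rcases eq_or_ne k (-1) with rfl | hk'
    · refine .of_head ?_
      simp only [tail, negWord_apply]; split_ifs <;> omega
    · refine .of_second ?_ ?_ <;> simp only [tail, negWord_apply] <;> split_ifs <;> omega
  · rcases eq_or_ne k (-1) with rfl | hk
    · refine .of_second ?_ ?_ <;> simp only [tail, negWord_apply, singleSeq_apply] <;>
        split_ifs <;> omega
    · refine .of_head ?_
      simp only [tail, negWord_apply, singleSeq_apply]; split_ifs <;> omega

theorem not_lexLess_posWord (hφ : IsEquivariant (companionMatrix r 1) φ) (hr : 3 ≤ r)
    {ε : PrimarySet l} (hε : ε ∈ X) (n : ℤ) (j : ℕ) :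
    ¬ LexLess (tail (posWord l r j).1 0) (tail ε.1 n) := by
  have happly (k : ℤ) : (singleSeq l (-1) + singleSeq l (j + 2)).1 k =
      (if k = -1 then 1 else 0) + if k = j + 2 then 1 else 0 := by
    simp [singleSeq_apply]
  refine not_lexLess_of_map_eq hX hinj (hφ.map_posWord (by omega) j) (fun heq => ?_) ?_ ?_
    (fun k hk => ?_) (fun k => .of_head ?_) hε n
  · have := congrArg (fun ε : PrimarySet l => ε.1 (-1)) heq
    simp only [happly, posWord_apply] at this
    split_ifs at this <;> omega
  · exact finite_support_of_Icc 0 (j + 1) fun k hk => by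
      rw [posWord_apply, if_neg (by omega), if_neg (by omega)]
  · exact finite_support_of_Icc (-1) (j + 2) fun k hk => by
      rw [happly, if_neg (by omega), if_neg (by omega)]
  · rcases eq_or_ne k (j + 1) with rfl | hk'
    · refine .of_second ?_ ?_ <;> simp only [tail, posWord_apply] <;> split_ifs <;> omega
    · refine .of_head ?_
      simp only [tail, posWord_apply]; split_ifs <;> omega
  · simp only [tail, happly, posWord_apply]; split_ifs <;> omega

theorem digits_of_neg (hφ : IsEquivariant (companionMatrix r (-1)) φ) (hr : 1 ≤ r)
    {ε : PrimarySet l} (hε : ε ∈ X) (n : ℤ) :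
    ε.1 n ≤ r ∧ (ε.1 n = r → ε.1 (n + 1) = 0 ∨ ∀ k, n + 2 ≤ k → ε.1 k = 0) := by
  have hnot := not_lexLess_negWord hX hinj hφ hr hε n
  have hdigit {j : ℕ} := le_of_not_lexLess (n := j) hnot
  simp only [tail, negWord_apply] at hdigit
  refine ⟨by simpa using hdigit (j := 0), fun hn => or_iff_not_imp_left.2 fun hsecond => ?_⟩
  have hone : ε.1 (n + 1) ≤ 1 := by
    simpa using hdigit (j := 1) fun m hm => by simp [Nat.lt_one_iff.1 hm, hn]
  have hzero (j : ℕ) : ε.1 (n + (j + 2 : ℕ)) = 0 := by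
    induction j using Nat.strong_induction_on with
    | _ j ih =>
      refine Nat.le_zero.1 ((hdigit fun m hm => ?_).trans_eq ?_)
      · match m with
        | 0 => simp [hn]
        | 1 => simp only [Nat.cast_one, zero_add, one_ne_zero, ↓reduceIte]; omega
        | m + 2 => rw [ih m (by omega), if_neg (by omega), if_neg (by omega)]
      · rw [if_neg (by omega), if_neg (by omega)]
  intro k hk
  rw [← hzero (k - n - 2).toNat, show n + ((k - n - 2).toNat + 2 : ℕ) = k by omega]

theorem mem_symbolicCompactum_of_pos (hφ : IsEquivariant (companionMatrix r 1) φ) (hr : 3 ≤ r)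
    {ε : PrimarySet l} (hε : ε ∈ X) : ε ∈ symbolicCompactum l r 1 := by
  have hnot := not_lexLess_posWord hX hinj hφ hr hε
  refine ⟨fun hσ => by omega, fun _ => ⟨fun n => ?_, fun n j => ?_⟩⟩
  · have hhead := le_of_not_lexLess (n := 0) (hnot n 0) (by simp)
    simp only [tail, posWord_apply] at hhead
    split_ifs at hhead <;> simp only [CharP.cast_eq_zero, add_zero] at hhead <;> omega
  · rintro ⟨hfirst, hmiddle, hlast⟩
    refine hnot n (j + 1) ⟨j + 1, ?_, fun i hi => ?_⟩ <;> simp only [tail, posWord_apply]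
    · rw [show n + ((j + 1 : ℕ) : ℤ) = n + j + 1 by push_cast; ring]
      split_ifs <;> omega
    · rcases Nat.eq_zero_or_pos i with rfl | hi0
      · rw [if_pos (by omega), Nat.cast_zero, add_zero]; omega
      · have := hmiddle i hi0 (by omega)
        split_ifs <;> omega

end

theorem interior_nonempty_of_toralMap_image {M : Matrix (Fin 2) (Fin 2) ℤ} (hM : M.det ≠ 0)
    {F : Set Torus2} (hF : IsClosed F) (himage : toralMap M '' F = Set.univ) :
    (interior F).Nonempty := by
  let K := {y | toralMap M y = 0}
  have hK : K.Finite := Set.finite_of_ncard_ne_zero <| by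
    rw [ncard_toralMap_preimage hM]; exact Int.natAbs_ne_zero.2 hM
  have : Countable K := hK.countable.to_subtype
  have hcover : ⋃ κ : K, Homeomorph.subRight κ.1 ⁻¹' F = Set.univ := by
    refine Set.eq_univ_of_forall fun t => ?_
    obtain ⟨y, hy, heq⟩ := himage.ge (Set.mem_univ (toralMap M t))
    have hker : toralMap M (t - y) = 0 :=
      ((toralHom M).map_sub t y).trans (sub_eq_zero.2 heq.symm)
    exact Set.mem_iUnion.2 ⟨⟨t - y, hker⟩, by simpa using hy⟩
  obtain ⟨κ, hκ⟩ := nonempty_interior_of_iUnion_of_closed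
    (fun κ : K => hF.preimage (Homeomorph.subRight κ.1).continuous) hcover
  rw [← Homeomorph.preimage_interior] at hκ
  exact hκ.imp' _ fun _ => id

namespace IsQuadraticUnit

variable {r : ℕ} {σ : ℤ} {l c : ℝ} (h : IsQuadraticUnit r σ l c)
include h

theorem fut_mem_quadInts {ε : PrimarySet l} {N : ℤ} (hN : ∀ k, N ≤ k → ε.1 k = 0) (n : ℤ) :
    fut l ε.1 n ∈ quadInts l := by
  suffices hdown : ∀ (j : ℕ) (n : ℤ), N ≤ n + j → fut l ε.1 n ∈ quadInts l from
    hdown (N - n).toNat n (by omega)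
  intro j
  induction j with
  | zero =>
    intro n hn
    have hfut : fut l ε.1 n = 0 :=
      (tsum_congr fun k => by rw [hN _ (by omega)]; simp).trans tsum_zero
    exact ⟨(0, 0), by simp [hfut]⟩
  | succ j ih =>
    intro n hn
    obtain ⟨⟨a, b⟩, hab⟩ := ih (n + 1) (by push_cast at hn; omega)
    refine h.mem_quadInts_of_mul ⟨(ε.1 (n + 1) + a, b), ?_⟩
    rw [fut_rec h.pos.ne' ε.2, ← hab]
    push_cast; ring

theorem mem_symbolicCompactum_or_fut_mem_quadInts {φ : PrimarySet l → Torus2}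
    (hφ : IsEquivariant (companionMatrix r σ) φ) {X : Set (PrimarySet l)} (hX : IsTotalSet X)
    (hinj : Set.InjOn φ {ε | ε ∈ X ∧ (Function.support ε.1).Finite}) {ε : PrimarySet l}
    (hε : ε ∈ X) : ε ∈ symbolicCompactum l r σ ∨ fut l ε.1 0 ∈ quadInts l := by
  rcases h.cases with ⟨rfl, hr⟩ | ⟨rfl, hr⟩
  · have hdigits := digits_of_neg hX hinj hφ hr hε
    refine or_iff_not_imp_right.2 fun hfut => ⟨fun _ n => ⟨(hdigits n).1, fun hn => ?_⟩, by simp⟩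
    exact ((hdigits n).2 hn).resolve_right fun hzero => hfut (h.fut_mem_quadInts hzero 0)
  · exact Or.inl (mem_symbolicCompactum_of_pos hX hinj hφ hr hε)

variable {m n : ℤ} {X : Set (PrimarySet l)} (hclosed : IsClosed X) (hX : IsTotalSet X)
  (hinj : Set.InjOn (coding l c m n) {ε | ε ∈ X ∧ (Function.support ε.1).Finite})
  (hsurj : coding l c m n '' X = Set.univ)

include hclosed hX hinj hsurj in
theorem image_inter_symbolicCompactum :
    coding l c m n '' (X ∩ symbolicCompactum l r σ) = Set.univ := by
  have hcl : IsClosed (coding l c m n '' (X ∩ symbolicCompactum l r σ)) :=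
    (h.isCompact_image_coding m n (hclosed.inter (isClosed_symbolicCompactum l r σ))
      Set.inter_subset_right).isClosed
  let C : Set ℝ := Set.image2 (fun x y => (m + n * l) * x + y) (quadInts l) (quadInts l)
  have hC : C.Countable := (countable_quadInts l).image2 (countable_quadInts l) _
  have hae : ∀ᵐ t : Torus2, t ∈ coding l c m n '' (X ∩ symbolicCompactum l r σ) := by
    refine ae_torus_of_ae_torusMk (h.ae_torusMk_of_ae_eigenMk ?_)
    filter_upwards [ae_notMem_countable 0 hC] with w hw
    obtain ⟨ε, hε, he⟩ := hsurj.ge (Set.mem_univ (eigenMk l c (w 0, w 1)))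
    refine ⟨ε, ⟨hε, ?_⟩, he⟩
    refine (h.mem_symbolicCompactum_or_fut_mem_quadInts (h.isEquivariant_coding m n) hX hinj
      hε).resolve_right fun hfut => hw ?_
    obtain ⟨a, b, hab⟩ := (h.eigenMk_eq_iff _ _).1 he.symm
    exact ⟨_, hfut, _, mem_quadInts l a b, (congrArg Prod.fst hab).symm⟩
  exact Set.compl_empty_iff.1 ((hcl.isOpen_compl.measure_eq_zero_iff volume).1 hae)

theorem ne_zero_of_image_coding {Y : Set (PrimarySet l)} (hY : coding l c m n '' Y = Set.univ) :
    (m, n) ≠ (0, 0) := by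
  rintro ⟨⟩
  obtain ⟨ε, -, hε⟩ := hY.ge (Set.mem_univ (eigenMk l c (1, 0)))
  have hzero : eigenMk l c (0, 0) = eigenMk l c (1, 0) := by simpa [coding] using hε
  exact zero_ne_one (h.eigenMk_unstable_injective hzero)

include hclosed hX hinj hsurj in
theorem abs_quadNorm_eq_one (hshift : ∀ ε, shift ε ∈ X ↔ ε ∈ X)
    (hunique : ∃ t, ∃! ε, ε ∈ X ∧ coding l c m n ε = t) : |quadNorm r σ m n| = 1 := by
  let Y := X ∩ symbolicCompactum l r σ
  have hYsurj : coding l c m n '' Y = Set.univ :=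
    h.image_inter_symbolicCompactum hclosed hX hinj hsurj
  have hM := h.det_mulMatrix_ne_zero (h.ne_zero_of_image_coding hsurj)
  have hF : IsClosed (coding l c 1 0 '' Y) :=
    (h.isCompact_image_coding 1 0 (hclosed.inter (isClosed_symbolicCompactum l r σ))
      Set.inter_subset_right).isClosed
  have hmaps : Set.MapsTo (toralMap (companionMatrix r σ)) (coding l c 1 0 '' Y)
      (coding l c 1 0 '' Y) := by
    rintro _ ⟨ε, hε, rfl⟩
    exact ⟨shift ε, ⟨(hshift ε).2 hε.1, (shift_mem_symbolicCompactum ε).2 hε.2⟩,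
      h.coding_shift 1 0 ε⟩
  have hYuniv : coding l c 1 0 '' Y = Set.univ :=
    h.eq_univ_of_interior_nonempty hF hmaps <| interior_nonempty_of_toralMap_image hM hF <| by
      simpa only [Set.image_image, ← h.coding_eq_toralMap] using hYsurj
  obtain ⟨t, ε, ⟨-, hεt⟩, hε⟩ := hunique
  have hpreimage : {y | toralMap (mulMatrix r σ m n) y = t} = {coding l c 1 0 ε} := by
    refine Set.eq_singleton_iff_unique_mem.2 ⟨(h.coding_eq_toralMap m n ε).symm.trans hεt, ?_⟩
    intro y hy
    obtain ⟨ε', hε', rfl⟩ := hYuniv.ge (Set.mem_univ y)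
    rw [hε ε' ⟨hε'.1, (h.coding_eq_toralMap m n ε').trans hy⟩]
  rw [Int.abs_eq_natAbs, ← det_mulMatrix, ← ncard_toralMap_preimage hM t, hpreimage,
    Set.ncard_singleton, Nat.cast_one]

end IsQuadraticUnit

theorem isQuadraticUnit_companionMatrix {r : ℕ} {σ : ℤ}
    (h : (σ = -1 ∧ 1 ≤ r) ∨ (σ = 1 ∧ 3 ≤ r)) :
    IsQuadraticUnit r σ (eigenLam (companionMatrix r σ)) (eigenLamConj (companionMatrix r σ)) := by
  simpa [eigenLam, eigenLamConj, discrD, companionMatrix, Matrix.trace_fin_two,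
    Matrix.det_fin_two] using IsQuadraticUnit.of_sqrt h

theorem sqrt_discrD (M : Matrix (Fin 2) (Fin 2) ℤ) :
    √(discrD M) = eigenLam M - eigenLamConj M := by
  rw [eigenLam, eigenLamConj]
  ring

theorem eigenLam_companionMatrix_three : eigenLam (companionMatrix 3 1) = Real.goldenRatio + 1 := by
  have hD : discrD (companionMatrix 3 1) = 5 := by
    rw [discrD, companionMatrix, Matrix.trace_fin_two, Matrix.det_fin_two]
    norm_num
  rw [eigenLam, hD, Real.goldenRatio, companionMatrix, Matrix.trace_fin_two]
  norm_num
  ring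

section Companion

variable {r : ℕ} {σ : ℤ} (h : (σ = -1 ∧ 1 ≤ r) ∨ (σ = 1 ∧ 3 ≤ r))
include h

theorem isLMap_coding (m n : ℤ) :
    IsLMap r σ ((m + n * eigenLam (companionMatrix r σ)) / √(discrD (companionMatrix r σ)))
      (coding _ (eigenLamConj (companionMatrix r σ)) m n) := by
  have hq := isQuadraticUnit_companionMatrix h
  intro ε
  refine (hq.tendsto_coding m n ε).congr fun N => ?_
  generalize ∑ k ∈ Finset.Icc (-(N : ℤ)) N,
    (ε.1 k : ℝ) * eigenLam (companionMatrix r σ) ^ (-k) = S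
  rw [sqrt_discrD]
  have hc := hq.conj_eq
  ext i
  fin_cases i <;> simp only [eigenMk_apply, Fin.zero_eta, Fin.mk_one, Matrix.cons_val_zero,
    Matrix.cons_val_one] <;> congr 1
  · ring
  · rw [hc]
    ring

theorem isBijectiveArithmeticCoding_coding {m n : ℤ} (hN : |quadNorm r σ m n| = 1) :
    IsBijectiveArithmeticCoding (companionMatrix r σ)
      (coding _ (eigenLamConj (companionMatrix r σ)) m n) (symbolicCompactum _ r σ) := by
  have hq := isQuadraticUnit_companionMatrix h
  have hmn : (m, n) ≠ (0, 0) := by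
    rintro ⟨⟩
    simp [quadNorm] at hN
  exact ⟨hq.isArithmeticCoding hmn, hq.ae_existsUnique_of_quadNorm hN⟩

theorem exists_isBijectiveArithmeticCoding_iff
    (φ : PrimarySet (eigenLam (companionMatrix r σ)) → Torus2) :
    (∃ X, IsBijectiveArithmeticCoding (companionMatrix r σ) φ X) ↔
      ∃ x ∈ quadUnits r σ (eigenLam (companionMatrix r σ)),
        IsLMap r σ (x / √(discrD (companionMatrix r σ))) φ := by
  constructor
  · rintro ⟨X, hX, hae⟩
    have hq := isQuadraticUnit_companionMatrix h
    obtain ⟨m, n, rfl⟩ := hq.exists_eq_coding ⟨hX.map_add, hX.continuousOn, hX.map_shift⟩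
    have hN := hq.abs_quadNorm_eq_one hX.isClosed hX.total hX.injOn_finite hX.surjective
      hX.shift_invariant hae.exists
    exact ⟨_, ⟨m, n, hN, rfl⟩, isLMap_coding h m n⟩
  · rintro ⟨_, ⟨m, n, hN, rfl⟩, hφ⟩
    obtain rfl : φ = coding _ _ m n :=
      funext fun ε => tendsto_nhds_unique (hφ ε) (isLMap_coding h m n ε)
    exact ⟨_, isBijectiveArithmeticCoding_coding h hN⟩

theorem exists_isBijectiveArithmeticCoding_iff_zpow {θ : ℝ}
    (hθ : ∀ x, x ∈ quadUnits r σ (eigenLam (companionMatrix r σ)) ↔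
      ∃ (s : ℝ) (k : ℤ), (s = 1 ∨ s = -1) ∧ x = s * θ ^ k)
    (φ : PrimarySet (eigenLam (companionMatrix r σ)) → Torus2) :
    (∃ X, IsBijectiveArithmeticCoding (companionMatrix r σ) φ X) ↔
      ∃ (s : ℝ) (k : ℤ), (s = 1 ∨ s = -1) ∧
        IsLMap r σ (s * θ ^ k / √(discrD (companionMatrix r σ))) φ := by
  rw [exists_isBijectiveArithmeticCoding_iff h]
  constructor
  · rintro ⟨x, hx, hφ⟩
    obtain ⟨s, k, hs, rfl⟩ := (hθ x).1 hx
    exact ⟨s, k, hs, hφ⟩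
  · rintro ⟨s, k, hs, hφ⟩
    exact ⟨_, (hθ _).2 ⟨s, k, hs, rfl⟩, hφ⟩

theorem discrD_mul_linear_div_sqrt (m n : ℤ) :
    discrD (companionMatrix r σ) *
      ((m + n * eigenLam (companionMatrix r σ)) / √(discrD (companionMatrix r σ)) *
        (-(m + n * eigenLamConj (companionMatrix r σ)) / √(discrD (companionMatrix r σ)))) =
      -quadNorm r σ m n := by
  have hq := isQuadraticUnit_companionMatrix h
  have hpos : 0 < √(discrD (companionMatrix r σ)) := (sqrt_discrD _).symm ▸ hq.sub_pos
  rw [← hq.linear_mul_conj_linear, div_mul_div_comm,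
    Real.mul_self_sqrt (Real.sqrt_pos.1 hpos).le, mul_div_cancel₀ _ (Real.sqrt_pos.1 hpos).ne',
    mul_neg]

end Companion

theorem theorem2p2 (r : ℕ) (σ : ℤ) (h : (σ = -1 ∧ 1 ≤ r) ∨ (σ = 1 ∧ 3 ≤ r)) :
    -- a bijective arithmetic coding exists
    (∃ φ X, IsBijectiveArithmeticCoding (companionMatrix r σ) φ X) ∧
    -- the bijective arithmetic codings are exactly the maps `L_ξ` with `ξ = ±λ^k / √D`
    (¬ (r = 3 ∧ σ = 1) → ∀ φ,
      (∃ X, IsBijectiveArithmeticCoding (companionMatrix r σ) φ X) ↔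
        ∃ (s : ℝ) (k : ℤ), (s = 1 ∨ s = -1) ∧
          IsLMap r σ (s * eigenLam (companionMatrix r σ) ^ k /
            Real.sqrt (discrD (companionMatrix r σ))) φ) ∧
    -- in the exceptional case they are exactly the maps `L_ξ` with `ξ = ±θ^k / √D`
    (r = 3 ∧ σ = 1 → ∀ φ,
      (∃ X, IsBijectiveArithmeticCoding (companionMatrix r σ) φ X) ↔
        ∃ (s : ℝ) (k : ℤ), (s = 1 ∨ s = -1) ∧
          IsLMap r σ (s * Real.goldenRatio ^ k /
            Real.sqrt (discrD (companionMatrix r σ))) φ) ∧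
    -- for `ξ = (m + n λ) / √D ≠ 0`, the map `L_ξ` is `|D N(ξ)|`-to-one on the symbolic compactum
    (∀ m n : ℤ, (m, n) ≠ (0, 0) →
      ∀ ξ ξ' : ℝ,
        ξ = (m + n * eigenLam (companionMatrix r σ)) /
          Real.sqrt (discrD (companionMatrix r σ)) →
        ξ' = -(m + n * eigenLamConj (companionMatrix r σ)) /
          Real.sqrt (discrD (companionMatrix r σ)) →
        ∃ φ, IsLMap r σ ξ φ ∧
          ∀ᵐ x ∂(volume : Measure Torus2),
            (Set.ncard {ε | ε ∈ symbolicCompactum (eigenLam (companionMatrix r σ)) r σ ∧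
              φ ε = x} : ℝ) = |discrD (companionMatrix r σ) * (ξ * ξ')|) := by
  have hq := isQuadraticUnit_companionMatrix h
  refine ⟨?_, fun hexc => ?_, ?_, ?_⟩
  · exact ⟨_, _, isBijectiveArithmeticCoding_coding h (m := 1) (n := 0) (by simp [quadNorm])⟩
  · exact exists_isBijectiveArithmeticCoding_iff_zpow h fun _ => hq.mem_quadUnits_iff hexc
  · rintro ⟨rfl, rfl⟩
    refine exists_isBijectiveArithmeticCoding_iff_zpow h fun _ => ?_
    rw [eigenLam_companionMatrix_three, quadUnits_goldenRatio_add_one]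
    exact IsQuadraticUnit.goldenRatio.mem_quadUnits_iff (by simp)
  · rintro m n hmn _ _ rfl rfl
    refine ⟨_, isLMap_coding h m n, (hq.ae_ncard_coding hmn).mono fun t ht => ?_⟩
    rw [ht, discrD_mul_linear_div_sqrt h, abs_neg, Nat.cast_natAbs, Int.cast_abs]
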